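/- Let $J=-J^T$ and $R=R^T\ge 0$ be real $n\times n$ matrices; consider $\dot x=(J-R)x$ with Hamiltonian $H(x)=\tfrac12x^Tx$, and put $L_1=\bar R=-R$, $L_2=J$, $C=[L_1,[L_1,L_2]]$, $D=[L_2,[L_1,L_2]]$, where $[X,Y]=XY-YX$. Step size tuples $a,b\in\mathbb R^m$ are of *class a* if $a_i=a_{m+1-i}$ for $1\le i\le m$, $b_m=0$ and $b_i=b_{m-i}$ for $1\le i\le m-1$; they are of *class b* if $a_1=0$, $a_i=a_{m+2-i}$ for $2\le i\le m$ and $b_i=b_{m+1-i}$ for $1\le i\le m$. If $(a,b)$ is of class a or of class b, there are unique real numbers $e_{k_\ell}=e_{k_\ell}(a,b)$ such that, for two free noncommuting indeterminates $X,Y$ and with $C=[X,[X,Y]]$, $D=[Y,[X,Y]]$, as formal power series in $h$, $$\prod_{j=1}^m e^{a_jhX}e^{b_jhY}=\exp\Big(h(e_{1_1}X+e_{1_2}Y)+h^3(e_{3_1}C+e_{3_2}D)+h^5\big(e_{5_1}[X,[X,C]]+e_{5_2}[X,[X,D]]+e_{5_3}[X,[Y,D]]+e_{5_4}[Y,[X,C]]+e_{5_5}[Y,[Y,C]]+e_{5_6}[Y,[Y,D]]\big)\Big)+\mathcal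 O(h^7).$$ Put $c=e_{3_1}(a,b)$ and $\tilde e_{5_1}=e_{5_1}(a,b)-c^2$. Let $m\ge5$ and $a_j,b_j\ge0$ for all $j$. **Case a.** Suppose $[L_1,D]=0$, $(a,b)$ is of class a, and $e_{1_1}=e_{1_2}=1$, $e_{3_2}=0$, $e_{5_4}=e_{5_6}=0$. Put $Z=\tilde e_{5_1}[L_1,[L_1,C]]+e_{5_3}[L_1,[L_2,D]]$. **Case b.** Suppose $[L_2,D]=0$, $(a,b)$ is of class b, and $e_{1_1}=e_{1_2}=1$, $e_{3_2}=0$, $e_{5_2}=e_{5_4}=0$. Put $Z=\tilde e_{5_1}[L_1,[L_1,C]]+e_{5_5}[L_2,[L_2,C]]$. In both cases $C$ and $Z$ are skew-symmetric, and for all weight tuples $\zeta^{[1]},\zeta^{[2]}\in\mathbb R^m$ with the same class symmetry as $(a,b)$ and $\sum_{j}(\zeta^{[1]}_j+\zeta^{[2]}_j)=1$ (for instance $\zeta^{[1]}=0$, $\zeta^{[2]}=b$) the scheme $$\Phi_h=\prod_{j=1}^m\exp\big(a_jhL_1-\zeta^{[1]}_jh^5Z\big)\exp\big(b_jh(L_2-ch^2C)-\zeta^{[2]}_jh^5Z\big)$$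 is of order six, that is, $\Phi_h=\exp\big(h(J-R)+\mathcal O(h^7)\big)$ as $h\to0$, and dissipation-preserving, that is, $H(\Phi_hx)\le H(x)$ for all $h\ge0$ and all $x\in\mathbb R^n$. **Tabulated solutions for $m=5$.** There is a nonnegative class-a solution $(a,b)$ of the equations of Case a whose step sizes agree with the following values up to $5\cdot10^{-16}$ and whose coefficients agree with them up to $10^{-16}$: $a_1=0.0741652386084523$, $a_2=0.3312015955219320$, $a_3=0.1892663317392310$, $b_1=0.2357603332527950$, $b_2=0.2642396667472050$; $e_{3_1}=3.4513723374828328\cdot10^{-3}$, $\tilde e_{5_1}=-2.8754632332335723\cdot10^{-5}$, $e_{5_3}=-7.16942170001536\cdot10^{-6}$, $e_{5_2}=-4.223687444832161\cdot10^{-5}$, $e_{5_5}=-1.3885239090889685\cdot10^{-5}$. There is a nonnegative class-b solution of the equations of Case b with, in the same sense, $b_1=0.0951068381417148$, $b_2=0.2665630297195250$, $b_3=0.2766602642775210$, $a_2=0.2216735783842150$, $a_3=0.2783264216157850$; $e_{3_1}=2.7595070959696467\cdot10^{-3}$, $\tilde e_{5_1}=-1.4777636968353257\cdot10^{-5}$,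 $e_{5_5}=1.3097476006184691\cdot10^{-5}$, $e_{5_3}=1.2345801613546542\cdot10^{-5}$, $e_{5_6}=1.5869088947135458\cdot10^{-5}$. -/

import Mathlib

namespace PHSplitting

open Filter Topology Asymptotics

section Commutators

variable {A : Type*} [Ring A]

/-- The commutator `C = [X, [X, Y]]`. -/
def commC (X Y : A) : A := ⁅X, ⁅X, Y⁆⁆

/-- The commutator `D = [Y, [X, Y]]`. -/
def commD (X Y : A) : A := ⁅Y, ⁅X, Y⁆⁆

end Commutators

/-! ### The two symmetric classes of step size tuples

Tuples `a = (a_1, …, a_m)` and `b = (b_1, …, b_m)` are functions on `Fin m`; the entry with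
(one-based) number `i` is the value at `i - 1`. -/

/-- Class a: `a_i = a_{m+1-i}`, `b_m = 0` and `b_i = b_{m-i}`. -/
def IsClassA {m : ℕ} (a b : Fin m → ℝ) : Prop :=
  (∀ i j : Fin m, (i : ℕ) + j + 1 = m → a i = a j) ∧
  (∀ i : Fin m, (i : ℕ) + 1 = m → b i = 0) ∧
  (∀ i j : Fin m, (i : ℕ) + j + 2 = m → b i = b j)

/-- Class b: `a_1 = 0`, `a_i = a_{m+2-i}` for `i ≥ 2`, and `b_i = b_{m+1-i}`. -/
def IsClassB {m : ℕ} (a b : Fin m → ℝ) : Prop :=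
  (∀ i : Fin m, (i : ℕ) = 0 → a i = 0) ∧
  (∀ i j : Fin m, (i : ℕ) + j = m → a i = a j) ∧
  (∀ i j : Fin m, (i : ℕ) + j + 1 = m → b i = b j)

/-! ### The order coefficients `e_{k_ℓ}(a, b)`

They are the coordinates of the formal (Baker-Campbell-Hausdorff) exponent of a symmetric scheme in
two free noncommuting indeterminates, up to order six in the step size. -/

/-- The free associative real algebra in two noncommuting indeterminates. -/
abbrev FreeAlg : Type := FreeAlgebra ℝ (Fin 2)

/-- The first indeterminate, which stands for `L^{[1]}`. -/
noncomputable def genX : FreeAlg := FreeAlgebra.ι ℝ 0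

/-- The second indeterminate, which stands for `L^{[2]}`. -/
noncomputable def genY : FreeAlg := FreeAlgebra.ι ℝ 1

/-- The exponential `∑ T ^ k / k!` of a formal power series `T` (in the step size, with noncommuting
coefficients) without constant term; then `T ^ k` does not contribute to orders below `k`. -/
noncomputable def formalExp (T : PowerSeries FreeAlg) : PowerSeries FreeAlg :=
  PowerSeries.mk fun N =>
    ∑ k ∈ Finset.range (N + 1), ((Nat.factorial k : ℝ)⁻¹) • PowerSeries.coeff N (T ^ k)

/-- The formal splitting product `∏_{j=1}^m exp(a_j h X) exp(b_j h Y)`, factors in the order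
`j = 1, …, m` from left to right. -/
noncomputable def formalProduct {m : ℕ} (a b : Fin m → ℝ) : PowerSeries FreeAlg :=
  (List.ofFn fun j : Fin m =>
    formalExp (PowerSeries.monomial 1 (a j • genX)) *
      formalExp (PowerSeries.monomial 1 (b j • genY))).prod

/-- A family of values for the coefficients `e_{k_ℓ}`. -/
@[ext] structure OrderCoeffs where
  e11 : ℝ
  e12 : ℝ
  e31 : ℝ
  e32 : ℝ
  e51 : ℝ
  e52 : ℝ
  e53 : ℝ
  e54 : ℝ
  e55 : ℝ
  e56 : ℝ

instance : Nonempty OrderCoeffs := ⟨⟨0, 0, 0, 0, 0, 0, 0, 0, 0, 0⟩⟩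

/-- The exponent
`h (e₁₁ X + e₁₂ Y) + h³ (e₃₁ C + e₃₂ D) + h⁵ (e₅₁ [X,[X,C]] + e₅₂ [X,[X,D]] + e₅₃ [X,[Y,D]]
  + e₅₄ [Y,[X,C]] + e₅₅ [Y,[Y,C]] + e₅₆ [Y,[Y,D]])`. -/
noncomputable def formalExponent (e : OrderCoeffs) : PowerSeries FreeAlg :=
  PowerSeries.monomial 1 (e.e11 • genX + e.e12 • genY) +
  PowerSeries.monomial 3 (e.e31 • commC genX genY + e.e32 • commD genX genY) +
  PowerSeries.monomial 5
    (e.e51 • ⁅genX, ⁅genX, commC genX genY⁆⁆ + e.e52 • ⁅genX, ⁅genX, commD genX genY⁆⁆ +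
     e.e53 • ⁅genX, ⁅genY, commD genX genY⁆⁆ + e.e54 • ⁅genY, ⁅genX, commC genX genY⁆⁆ +
     e.e55 • ⁅genY, ⁅genY, commC genX genY⁆⁆ + e.e56 • ⁅genY, ⁅genY, commD genX genY⁆⁆)

/-- The formal splitting product equals the exponential of `formalExponent e`, up to terms of order
seven and higher in the step size. -/
def IsOrderExpansion {m : ℕ} (a b : Fin m → ℝ) (e : OrderCoeffs) : Prop :=
  ∀ N : ℕ, N < 7 →
    PowerSeries.coeff N (formalProduct a b) = PowerSeries.coeff N (formalExp (formalExponent e))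

/-- The order coefficients `e_{k_ℓ}(a, b)` of a symmetric scheme: the family for which the formal
splitting product has the expansion above. -/
noncomputable def orderCoeffs {m : ℕ} (a b : Fin m → ℝ) : OrderCoeffs :=
  Classical.epsilon (IsOrderExpansion a b)

/-- `ẽ₅₁ = e₅₁ - c²` with `c = e₃₁`. -/
noncomputable def e51Tilde {m : ℕ} (a b : Fin m → ℝ) : ℝ :=
  (orderCoeffs a b).e51 - (orderCoeffs a b).e31 ^ 2

/-- `(a, b)` is a nonnegative solution, with class-a symmetry, of the class-a order conditions. -/
structure SolvesClassA {m : ℕ} (a b : Fin m → ℝ) : Prop where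
  isClassA : IsClassA a b
  a_nonneg : ∀ j, 0 ≤ a j
  b_nonneg : ∀ j, 0 ≤ b j
  e11 : (orderCoeffs a b).e11 = 1
  e12 : (orderCoeffs a b).e12 = 1
  e32 : (orderCoeffs a b).e32 = 0
  e54 : (orderCoeffs a b).e54 = 0
  e56 : (orderCoeffs a b).e56 = 0

/-- `(a, b)` is a nonnegative solution, with class-b symmetry, of the class-b order conditions. -/
structure SolvesClassB {m : ℕ} (a b : Fin m → ℝ) : Prop where
  isClassB : IsClassB a b
  a_nonneg : ∀ j, 0 ≤ a j
  b_nonneg : ∀ j, 0 ≤ b j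
  e11 : (orderCoeffs a b).e11 = 1
  e12 : (orderCoeffs a b).e12 = 1
  e32 : (orderCoeffs a b).e32 = 0
  e52 : (orderCoeffs a b).e52 = 0
  e54 : (orderCoeffs a b).e54 = 0

/-! ### The splitting schemes -/

section Schemes

variable {n : ℕ}

/-- The fifth-order force gradient of class a,
`Z = ẽ₅₁ [L₁,[L₁,C]] + e₅₃ [L₁,[L₂,D]]`. -/
noncomputable def gradientA {m : ℕ} (a b : Fin m → ℝ) (L₁ L₂ : Matrix (Fin n) (Fin n) ℝ) :
    Matrix (Fin n) (Fin n) ℝ :=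
  e51Tilde a b • ⁅L₁, ⁅L₁, commC L₁ L₂⁆⁆ + (orderCoeffs a b).e53 • ⁅L₁, ⁅L₂, commD L₁ L₂⁆⁆

/-- The fifth-order force gradient of class b,
`Z = ẽ₅₁ [L₁,[L₁,C]] + e₅₅ [L₂,[L₂,C]]`. -/
noncomputable def gradientB {m : ℕ} (a b : Fin m → ℝ) (L₁ L₂ : Matrix (Fin n) (Fin n) ℝ) :
    Matrix (Fin n) (Fin n) ℝ :=
  e51Tilde a b • ⁅L₁, ⁅L₁, commC L₁ L₂⁆⁆ + (orderCoeffs a b).e55 • ⁅L₂, ⁅L₂, commC L₁ L₂⁆⁆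

/-- One step of size `h` of the splitting scheme with force gradients,
`Φ_h = ∏_{j=1}^m exp(a_j h L₁ - ζ₁_j h⁵ Z) exp(b_j h (L₂ - c h² C) - ζ₂_j h⁵ Z)`, with `c = e₃₁(a, b)`
and `C = [L₁, [L₁, L₂]]`. The gradient `-c h³ C` sits in the energy-conserving subproblem; the
weights `ζ₁`, `ζ₂` say how `-h⁵ Z` is distributed over the stages. With `ζ₁ = 0` and `ζ₂ = b` this
is `∏ exp(a_j h L₁) exp(b_j h (L₂ - c h² C - h⁴ Z))`. -/
noncomputable def scheme {m : ℕ} (a b ζ₁ ζ₂ : Fin m → ℝ) (L₁ L₂ Z : Matrix (Fin n) (Fin n) ℝ)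
    (h : ℝ) : Matrix (Fin n) (Fin n) ℝ :=
  (List.ofFn fun j : Fin m =>
    NormedSpace.exp ((a j * h) • L₁ - (ζ₁ j * h ^ 5) • Z) *
      NormedSpace.exp
        ((b j * h) • (L₂ - ((orderCoeffs a b).e31 * h ^ 2) • commC L₁ L₂) -
          (ζ₂ j * h ^ 5) • Z)).prod

/-- The one-step method `Φ` is of order `p` for `x' = L x`: `Φ_h = exp(h L + O(h^{p+1}))` as
`h → 0`. -/
def HasOrder (Φ : ℝ → Matrix (Fin n) (Fin n) ℝ) (L : Matrix (Fin n) (Fin n) ℝ) (p : ℕ) : Prop :=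
  ∃ E : ℝ → Matrix (Fin n) (Fin n) ℝ,
    (∀ i j, (fun h => E h i j) =O[𝓝 0] fun h : ℝ => h ^ (p + 1)) ∧
    ∀ᶠ h in 𝓝 (0 : ℝ), Φ h = NormedSpace.exp (h • L + E h)

/-- The Hamiltonian `H(x) = xᵀ x / 2`. -/
noncomputable def hamiltonian (x : Fin n → ℝ) : ℝ := (1 / 2) * (x ⬝ᵥ x)

/-- The one-step method `Φ` preserves the dissipation inequality: for every step size `h ≥ 0` a step
does not increase the Hamiltonian. -/
def DissipationPreserving (Φ : ℝ → Matrix (Fin n) (Fin n) ℝ) : Prop :=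
  ∀ h : ℝ, 0 ≤ h → ∀ x : Fin n → ℝ, hamiltonian (Matrix.mulVec (Φ h) x) ≤ hamiltonian x

end Schemes

end PHSplitting

/-! After one trivial factor is deleted, a scheme of class a or b is a palindromic product, hence
built from the inside out by multiplying with the same stage on both sides. The symmetric
Baker-Campbell-Hausdorff formula `seriesExp_sandwich` keeps the exponent odd in h up to order six,
and Jacobi's identity brings its terms into the span of X, Y, C, D and the six quintic brackets.
This gives a recursion for the ten coefficients (`eqUpToSix_step`) that is valid in every real
algebra. In the free algebra the brackets of each order are linearly independent, so the recursion
computes precisely the coefficients of the definition.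

The force gradients pass through the same recursion. Replacing Y by Y - c h² C changes e₁₂ Y by -c
e₁₂ h² C and C by -c h² [X,[X,C]], whereas Z enters up to order six only through its total weight.
With e₁₂ = 1, e₃₂ = 0 and c = e₃₁ the cubic term cancels, and the quintic one becomes the original
one minus c² [X,[X,C]] minus Z. The order conditions and the vanishing bracket (in case a also
[L₂,C] = 0, by Jacobi) reduce this to zero. `HasJet` transfers the formal identity to matrices, and
a local logarithm moves the error into the exponent.

For dissipation, brackets with an even number of symmetric entries are skew, so C and Z do not
contribute to yᵀSy for the exponent S of a factor. What is left is -a_j h yᵀRy or zero, and then exp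
S does not increase the norm.

The tabulated schemes form a three-parameter family with three polynomial equations. A contraction
argument with rational arithmetic (`exists_zero_near`) yields an exact zero within 10⁻²⁰ of a
rational point. -/

namespace PHSplitting

open Filter Topology Asymptotics

/-! ### Formal exponentials of odd exponents and the symmetric BCH formula -/

section FormalExponential

set_option linter.unusedSectionVars false

variable {A : Type*} [Ring A] [Algebra ℝ A]

/-- The exponential of a formal power series without constant term over a real algebra. -/
noncomputable def seriesExp (T : PowerSeries A) : PowerSeries A :=
  PowerSeries.mk fun N =>
    ∑ k ∈ Finset.range (N + 1), ((Nat.factorial k : ℝ)⁻¹) • PowerSeries.coeff N (T ^ k)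

theorem formalExp_eq_seriesExp (T : PowerSeries FreeAlg) : formalExp T = seriesExp T := rfl

/-- The odd polynomial `h w₁ + h³ w₃ + h⁵ w₅`. -/
noncomputable def oddSeries (w₁ w₃ w₅ : A) : PowerSeries A :=
  PowerSeries.monomial 1 w₁ + PowerSeries.monomial 3 w₃ + PowerSeries.monomial 5 w₅

theorem monomial_one_eq_oddSeries (w : A) : PowerSeries.monomial 1 w = oddSeries w 0 0 := by
  simp [oddSeries]

section Coefficients

variable (w₁ w₃ w₅ : A)

theorem coeff_oddSeries (N : ℕ) : PowerSeries.coeff N (oddSeries w₁ w₃ w₅) =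
    (if N = 1 then w₁ else 0) + (if N = 3 then w₃ else 0) + (if N = 5 then w₅ else 0) := by
  simp [oddSeries, PowerSeries.coeff_monomial]

theorem constantCoeff_oddSeries : PowerSeries.constantCoeff (oddSeries w₁ w₃ w₅) = 0 := by
  simpa using coeff_oddSeries w₁ w₃ w₅ 0

theorem coeff_one_mul_oddSeries (P : PowerSeries A) :
    PowerSeries.coeff 1 (P * oddSeries w₁ w₃ w₅) = PowerSeries.coeff 0 P * w₁ := by
  simp [PowerSeries.coeff_mul, coeff_oddSeries, Finset.Nat.antidiagonal_succ]

theorem coeff_two_mul_oddSeries (P : PowerSeries A) :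
    PowerSeries.coeff 2 (P * oddSeries w₁ w₃ w₅) = PowerSeries.coeff 1 P * w₁ := by
  simp [PowerSeries.coeff_mul, coeff_oddSeries, Finset.Nat.antidiagonal_succ]

theorem coeff_three_mul_oddSeries (P : PowerSeries A) :
    PowerSeries.coeff 3 (P * oddSeries w₁ w₃ w₅) =
      PowerSeries.coeff 2 P * w₁ + PowerSeries.coeff 0 P * w₃ := by
  simp [PowerSeries.coeff_mul, coeff_oddSeries, Finset.Nat.antidiagonal_succ, add_comm]

theorem coeff_four_mul_oddSeries (P : PowerSeries A) :
    PowerSeries.coeff 4 (P * oddSeries w₁ w₃ w₅) =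
      PowerSeries.coeff 3 P * w₁ + PowerSeries.coeff 1 P * w₃ := by
  simp [PowerSeries.coeff_mul, coeff_oddSeries, Finset.Nat.antidiagonal_succ, add_comm]

theorem coeff_five_mul_oddSeries (P : PowerSeries A) :
    PowerSeries.coeff 5 (P * oddSeries w₁ w₃ w₅) =
      PowerSeries.coeff 4 P * w₁ + PowerSeries.coeff 2 P * w₃ + PowerSeries.coeff 0 P * w₅ := by
  simp [PowerSeries.coeff_mul, coeff_oddSeries, Finset.Nat.antidiagonal_succ]
  abel

theorem coeff_six_mul_oddSeries (P : PowerSeries A) :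
    PowerSeries.coeff 6 (P * oddSeries w₁ w₃ w₅) =
      PowerSeries.coeff 5 P * w₁ + PowerSeries.coeff 3 P * w₃ + PowerSeries.coeff 1 P * w₅ := by
  simp [PowerSeries.coeff_mul, coeff_oddSeries, Finset.Nat.antidiagonal_succ]
  abel

theorem coeff_zero_seriesExp_oddSeries :
    PowerSeries.coeff 0 (seriesExp (oddSeries w₁ w₃ w₅)) = 1 := by
  simp [seriesExp]

theorem coeff_one_seriesExp_oddSeries :
    PowerSeries.coeff 1 (seriesExp (oddSeries w₁ w₃ w₅)) = w₁ := by
  simp [seriesExp, Finset.sum_range_succ, coeff_oddSeries, PowerSeries.coeff_one]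

theorem coeff_two_seriesExp_oddSeries :
    PowerSeries.coeff 2 (seriesExp (oddSeries w₁ w₃ w₅)) = (1 / 2 : ℝ) • (w₁ * w₁) := by
  simp [seriesExp, Finset.sum_range_succ, pow_succ, coeff_two_mul_oddSeries,
    PowerSeries.coeff_one, coeff_oddSeries]

theorem coeff_three_seriesExp_oddSeries :
    PowerSeries.coeff 3 (seriesExp (oddSeries w₁ w₃ w₅)) =
      w₃ + (1 / 6 : ℝ) • (w₁ * w₁ * w₁) := by
  simp [seriesExp, Finset.sum_range_succ, pow_succ, coeff_two_mul_oddSeries,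
    coeff_three_mul_oddSeries, PowerSeries.coeff_one, coeff_oddSeries, constantCoeff_oddSeries,
    Nat.factorial]

theorem coeff_four_seriesExp_oddSeries :
    PowerSeries.coeff 4 (seriesExp (oddSeries w₁ w₃ w₅)) =
      (1 / 2 : ℝ) • (w₁ * w₃ + w₃ * w₁) + (1 / 24 : ℝ) • (w₁ * w₁ * w₁ * w₁) := by
  simp [seriesExp, Finset.sum_range_succ, pow_succ, coeff_one_mul_oddSeries, coeff_two_mul_oddSeries,
    coeff_three_mul_oddSeries, coeff_four_mul_oddSeries, PowerSeries.coeff_one, coeff_oddSeries,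
    constantCoeff_oddSeries, Nat.factorial]
  abel

theorem coeff_five_seriesExp_oddSeries :
    PowerSeries.coeff 5 (seriesExp (oddSeries w₁ w₃ w₅)) =
      w₅ + (1 / 6 : ℝ) • (w₁ * w₁ * w₃ + w₁ * w₃ * w₁ + w₃ * w₁ * w₁) +
        (1 / 120 : ℝ) • (w₁ * w₁ * w₁ * w₁ * w₁) := by
  simp [seriesExp, Finset.sum_range_succ, pow_succ, coeff_one_mul_oddSeries, coeff_two_mul_oddSeries,
    coeff_three_mul_oddSeries, coeff_four_mul_oddSeries, coeff_five_mul_oddSeries,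
    PowerSeries.coeff_one, coeff_oddSeries, constantCoeff_oddSeries, Nat.factorial, add_mul]
  abel

theorem coeff_six_seriesExp_oddSeries :
    PowerSeries.coeff 6 (seriesExp (oddSeries w₁ w₃ w₅)) =
      (1 / 2 : ℝ) • (w₁ * w₅ + w₅ * w₁ + w₃ * w₃) +
        (1 / 24 : ℝ) • (w₁ * w₁ * w₁ * w₃ + w₁ * w₁ * w₃ * w₁ + w₁ * w₃ * w₁ * w₁ +
          w₃ * w₁ * w₁ * w₁) + (1 / 720 : ℝ) • (w₁ * w₁ * w₁ * w₁ * w₁ * w₁) := by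
  simp [seriesExp, Finset.sum_range_succ, pow_succ, coeff_one_mul_oddSeries, coeff_two_mul_oddSeries,
    coeff_three_mul_oddSeries, coeff_four_mul_oddSeries, coeff_five_mul_oddSeries,
    coeff_six_mul_oddSeries, PowerSeries.coeff_one, coeff_oddSeries, constantCoeff_oddSeries, Nat.factorial, add_mul]
  abel

end Coefficients

/-- Two formal power series agree up to order six. -/
def EqUpToSix (P Q : PowerSeries A) : Prop :=
  ∀ N : ℕ, N < 7 → PowerSeries.coeff N P = PowerSeries.coeff N Q

namespace EqUpToSix

variable {P Q P' Q' S : PowerSeries A}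

theorem refl (P : PowerSeries A) : EqUpToSix P P := fun _ _ => rfl

theorem symm (h : EqUpToSix P Q) : EqUpToSix Q P := fun N hN => (h N hN).symm

theorem trans (h : EqUpToSix P Q) (h' : EqUpToSix Q S) : EqUpToSix P S :=
  fun N hN => (h N hN).trans (h' N hN)

theorem mul (h : EqUpToSix P Q) (h' : EqUpToSix P' Q') : EqUpToSix (P * P') (Q * Q') := by
  intro N hN
  rw [PowerSeries.coeff_mul, PowerSeries.coeff_mul]
  refine Finset.sum_congr rfl fun x hx => ?_
  have := Finset.HasAntidiagonal.mem_antidiagonal.1 hx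
  rw [h x.1 (by omega), h' x.2 (by omega)]

end EqUpToSix

/-- `P'` is, up to order six, the reflection `h ↦ -h` of `P` and inverse to `P`. -/
structure ReversibleWith (P P' : PowerSeries A) : Prop where
  reflect : ∀ N < 7, PowerSeries.coeff N P' = (-1 : ℝ) ^ N • PowerSeries.coeff N P
  mul_eq_one : EqUpToSix (P * P') 1
  eq_mul_one : EqUpToSix (P' * P) 1

/-- Inversion reverses the order of factors and h ↦ -h does not; on palindromes the two agree. -/
theorem ReversibleWith.sandwich {P P' Q Q' : PowerSeries A} (hP : ReversibleWith P P')
    (hQ : ReversibleWith Q Q') : ReversibleWith (P * Q * P) (P' * Q' * P') where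
  reflect := by
    have key : ∀ {S S' T T' : PowerSeries A},
        (∀ N < 7, PowerSeries.coeff N S' = (-1 : ℝ) ^ N • PowerSeries.coeff N S) →
        (∀ N < 7, PowerSeries.coeff N T' = (-1 : ℝ) ^ N • PowerSeries.coeff N T) →
        ∀ N < 7, PowerSeries.coeff N (S' * T') = (-1 : ℝ) ^ N • PowerSeries.coeff N (S * T) := by
      intro S S' T T' hS hT N hN
      rw [PowerSeries.coeff_mul, PowerSeries.coeff_mul, Finset.smul_sum]
      refine Finset.sum_congr rfl fun x hx => ?_
      have := Finset.HasAntidiagonal.mem_antidiagonal.1 hx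
      rw [hS x.1 (by omega), hT x.2 (by omega), smul_mul_smul_comm, ← pow_add, this]
    exact key (key hP.reflect hQ.reflect) hP.reflect
  mul_eq_one := by
    have h1 : EqUpToSix (P * Q * (P * P') * Q' * P') 1 := by
      have h2 := ((((EqUpToSix.refl (P * Q)).mul hP.mul_eq_one).mul (.refl Q')).mul (.refl P'))
      refine h2.trans ?_
      have h3 := ((EqUpToSix.refl P).mul hQ.mul_eq_one).mul (.refl P')
      rw [mul_one, mul_assoc P Q Q']
      refine h3.trans ?_
      rw [mul_one]
      exact hP.mul_eq_one
    simpa only [mul_assoc] using h1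
  eq_mul_one := by
    have h1 : EqUpToSix (P' * Q' * (P' * P) * Q * P) 1 := by
      have h2 := ((((EqUpToSix.refl (P' * Q')).mul hP.eq_mul_one).mul (.refl Q)).mul (.refl P))
      refine h2.trans ?_
      have h3 := ((EqUpToSix.refl P').mul hQ.eq_mul_one).mul (.refl P)
      rw [mul_one, mul_assoc P' Q' Q]
      refine h3.trans ?_
      rw [mul_one]
      exact hP.eq_mul_one
    simpa only [mul_assoc] using h1

theorem seriesExp_neg_mul (w₁ w₃ w₅ : A) :
    EqUpToSix (seriesExp (oddSeries w₁ w₃ w₅) * seriesExp (oddSeries (-w₁) (-w₃) (-w₅))) 1 := by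
  intro N hN
  interval_cases N <;>
    simp only [PowerSeries.coeff_mul, Finset.Nat.antidiagonal_succ, Finset.Nat.antidiagonal_zero,
      Finset.map_singleton, Finset.sum_cons, Finset.sum_singleton, Finset.map_cons,
      Function.Embedding.prodMap, Function.Embedding.coeFn_mk, Prod.map_apply,
      Function.Embedding.refl_apply, Nat.succ_eq_add_one, zero_add, Nat.reduceAdd,
      PowerSeries.coeff_one, if_true, one_ne_zero, if_false, OfNat.ofNat_ne_zero,
      coeff_zero_seriesExp_oddSeries, coeff_one_seriesExp_oddSeries, coeff_two_seriesExp_oddSeries,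
      coeff_three_seriesExp_oddSeries, coeff_four_seriesExp_oddSeries,
      coeff_five_seriesExp_oddSeries, coeff_six_seriesExp_oddSeries] <;>
    simp only [mul_add, add_mul, smul_mul_assoc, mul_smul_comm, smul_add,
      smul_smul, mul_assoc, neg_mul, mul_neg, one_mul, mul_one, neg_neg] <;>
    module

theorem reversibleWith_seriesExp (w₁ w₃ w₅ : A) :
    ReversibleWith (seriesExp (oddSeries w₁ w₃ w₅))
      (seriesExp (oddSeries (-w₁) (-w₃) (-w₅))) where
  reflect := by
    intro N hN
    interval_cases N <;>
    simp only [coeff_zero_seriesExp_oddSeries, coeff_one_seriesExp_oddSeries,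
      coeff_two_seriesExp_oddSeries, coeff_three_seriesExp_oddSeries,
      coeff_four_seriesExp_oddSeries, coeff_five_seriesExp_oddSeries,
      coeff_six_seriesExp_oddSeries, mul_neg, neg_mul, neg_neg] <;>
    module
  mul_eq_one := seriesExp_neg_mul w₁ w₃ w₅
  eq_mul_one := by simpa using seriesExp_neg_mul (-w₁) (-w₃) (-w₅)

/-- Reversible series with the same odd part agree. -/
theorem ReversibleWith.eqUpToSix {P P' Q Q' : PowerSeries A} (hP : ReversibleWith P P')
    (hQ : ReversibleWith Q Q') (h0 : PowerSeries.coeff 0 P = 1) (h0' : PowerSeries.coeff 0 Q = 1)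
    (h1 : PowerSeries.coeff 1 P = PowerSeries.coeff 1 Q)
    (h3 : PowerSeries.coeff 3 P = PowerSeries.coeff 3 Q)
    (h5 : PowerSeries.coeff 5 P = PowerSeries.coeff 5 Q) : EqUpToSix P Q := by
  -- In S(h) S(-h) = 1 the coefficients of even order express s₂, s₄, s₆ through coefficients of
  -- lower order, so the odd ones determine everything.
  have even : ∀ {S S' : PowerSeries A}, ReversibleWith S S' → PowerSeries.coeff 0 S = 1 →
      (∀ s : ℕ → A, (∀ N, PowerSeries.coeff N S = s N) →
        s 2 = (1 / 2 : ℝ) • (s 1 * s 1) ∧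
        s 4 = (1 / 2 : ℝ) • (s 1 * s 3 + s 3 * s 1 - s 2 * s 2) ∧
        s 6 = (1 / 2 : ℝ) • (s 1 * s 5 + s 5 * s 1 - s 2 * s 4 - s 4 * s 2 + s 3 * s 3)) := by
    intro S S' h hS s hs
    have hs0 : s 0 = 1 := by rw [← hs, hS]
    have c2 := h.mul_eq_one 2 (by norm_num)
    have c4 := h.mul_eq_one 4 (by norm_num)
    have c6 := h.mul_eq_one 6 (by norm_num)
    simp only [PowerSeries.coeff_mul, Finset.Nat.antidiagonal_succ, Finset.Nat.antidiagonal_zero,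
      Finset.map_singleton, Finset.sum_cons, Finset.sum_singleton, Finset.map_cons,
      Function.Embedding.prodMap, Function.Embedding.coeFn_mk, Prod.map_apply,
      Function.Embedding.refl_apply, Nat.succ_eq_add_one, zero_add, Nat.reduceAdd,
      PowerSeries.coeff_one, OfNat.ofNat_ne_zero, if_false,
      h.reflect 0 (by norm_num), h.reflect 1 (by norm_num), h.reflect 2 (by norm_num),
      h.reflect 3 (by norm_num), h.reflect 4 (by norm_num), h.reflect 5 (by norm_num),
      h.reflect 6 (by norm_num), hs, hs0, mul_smul_comm, one_mul, mul_one] at c2 c4 c6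
    refine ⟨?_, ?_, ?_⟩
    · linear_combination (norm := module) (1 / 2 : ℝ) • c2
    · linear_combination (norm := module) (1 / 2 : ℝ) • c4
    · linear_combination (norm := module) (1 / 2 : ℝ) • c6
  obtain ⟨p2, p4, p6⟩ := even hP h0 (fun N => PowerSeries.coeff N P) fun _ => rfl
  obtain ⟨q2, q4, q6⟩ := even hQ h0' (fun N => PowerSeries.coeff N Q) fun _ => rfl
  have h2 : PowerSeries.coeff 2 P = PowerSeries.coeff 2 Q := by rw [p2, q2, h1]
  have h4 : PowerSeries.coeff 4 P = PowerSeries.coeff 4 Q := by rw [p4, q4, h1, h2, h3]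
  have h6 : PowerSeries.coeff 6 P = PowerSeries.coeff 6 Q := by rw [p6, q6, h1, h2, h3, h4, h5]
  intro N hN
  interval_cases N
  exacts [h0.trans h0'.symm, h1, h2, h3, h4, h5, h6]

/-- The symmetric Baker-Campbell-Hausdorff formula up to order six. -/
theorem seriesExp_sandwich (u₁ u₃ u₅ v₁ v₃ v₅ : A) :
    EqUpToSix
      (seriesExp (oddSeries u₁ u₃ u₅) * seriesExp (oddSeries v₁ v₃ v₅) *
        seriesExp (oddSeries u₁ u₃ u₅))
      (seriesExp (oddSeries ((2 : ℝ) • u₁ + v₁)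
        ((2 : ℝ) • u₃ + v₃ - (1 / 6 : ℝ) • (⁅u₁, ⁅u₁, v₁⁆⁆ + ⁅v₁, ⁅u₁, v₁⁆⁆))
        ((2 : ℝ) • u₅ + v₅ - (1 / 6 : ℝ) • (⁅u₃, ⁅u₁, v₁⁆⁆ + ⁅u₁, ⁅u₃, v₁⁆⁆ + ⁅u₁, ⁅u₁, v₃⁆⁆ +
            ⁅v₃, ⁅u₁, v₁⁆⁆ + ⁅v₁, ⁅u₃, v₁⁆⁆ + ⁅v₁, ⁅u₁, v₃⁆⁆) +
          ((7 / 360 : ℝ) • ⁅u₁, ⁅u₁, ⁅u₁, ⁅u₁, v₁⁆⁆⁆⁆ + (1 / 60 : ℝ) • ⁅u₁, ⁅u₁, ⁅v₁, ⁅u₁, v₁⁆⁆⁆⁆ -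
            (1 / 90 : ℝ) • ⁅u₁, ⁅v₁, ⁅v₁, ⁅u₁, v₁⁆⁆⁆⁆ + (1 / 45 : ℝ) • ⁅v₁, ⁅u₁, ⁅u₁, ⁅u₁, v₁⁆⁆⁆⁆ +
            (1 / 30 : ℝ) • ⁅v₁, ⁅v₁, ⁅u₁, ⁅u₁, v₁⁆⁆⁆⁆ +
            (1 / 360 : ℝ) • ⁅v₁, ⁅v₁, ⁅v₁, ⁅u₁, v₁⁆⁆⁆⁆)))) := by
  -- Both sides are reversible, so besides the constant term only orders one, three and five are
  -- compared, as identities between words.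
  refine ((reversibleWith_seriesExp u₁ u₃ u₅).sandwich
    (reversibleWith_seriesExp v₁ v₃ v₅)).eqUpToSix (reversibleWith_seriesExp _ _ _) ?_
    (coeff_zero_seriesExp_oddSeries _ _ _) ?_ ?_ ?_ <;>
    simp only [PowerSeries.coeff_mul, Finset.Nat.antidiagonal_succ, Finset.Nat.antidiagonal_zero,
      Finset.map_singleton, Finset.sum_cons, Finset.sum_singleton, Finset.map_cons,
      Function.Embedding.prodMap, Function.Embedding.coeFn_mk, Prod.map_apply,
      Function.Embedding.refl_apply, Nat.succ_eq_add_one, zero_add, Nat.reduceAdd,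
      coeff_zero_seriesExp_oddSeries, coeff_one_seriesExp_oddSeries, coeff_two_seriesExp_oddSeries,
      coeff_three_seriesExp_oddSeries, coeff_four_seriesExp_oddSeries,
      coeff_five_seriesExp_oddSeries, Ring.lie_def] <;>
    simp only [mul_add, add_mul, mul_sub, sub_mul, smul_mul_assoc, mul_smul_comm, smul_add,
      smul_sub, smul_smul, mul_assoc, one_mul, mul_one]
  · module
  · module
  · module

end FormalExponential

/-! ### The recursion for the coefficients of palindromic products -/

section Palindromes

attribute [local instance] LieRing.ofAssociativeRing

/-- A stage of a splitting scheme: the subproblem (`true` for the first one), the step size, and the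
weight of the fifth-order gradient. -/
abbrev Stage : Type := Bool × ℝ × ℝ

/-- The coefficients after exchanging the two indeterminates. -/
def OrderCoeffs.swap (e : OrderCoeffs) : OrderCoeffs :=
  ⟨e.e12, e.e11, -e.e32, -e.e31, -e.e56, -e.e55, -e.e54, -e.e53, -e.e52, -e.e51⟩

/-- The coefficients after surrounding a symmetric scheme by two factors `exp(α h X)`. -/
noncomputable def OrderCoeffs.stepX (α : ℝ) (e : OrderCoeffs) : OrderCoeffs where
  e11 := 2 * α + e.e11
  e12 := e.e12
  e31 := e.e31 - 1 / 6 * (α * e.e12 * (α + e.e11))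
  e32 := e.e32 - 1 / 6 * (α * e.e12 * e.e12)
  e51 := e.e51 - 1 / 6 * (α * e.e31 * (α + e.e11)) +
    α * e.e12 * (7 / 360 * (α * α * α) + 7 / 180 * (α * α * e.e11) +
      1 / 45 * (α * e.e11 * e.e11) + 1 / 360 * (e.e11 * e.e11 * e.e11))
  e52 := e.e52 - 1 / 6 * (α * (α * e.e32 - e.e12 * e.e31 + e.e11 * e.e32)) +
    α * e.e12 * e.e12 * (1 / 60 * (α * α) + 1 / 90 * (α * e.e11) + 1 / 180 * (e.e11 * e.e11))
  e53 := e.e53 + 1 / 6 * (α * e.e12 * e.e32) +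
    α * e.e12 * e.e12 * e.e12 * (1 / 360 * e.e11 - 1 / 90 * α)
  e54 := e.e54 - 1 / 3 * (α * e.e12 * e.e31) +
    α * e.e12 * e.e12 * (1 / 45 * (α * α) + 1 / 30 * (α * e.e11) + 1 / 360 * (e.e11 * e.e11))
  e55 := e.e55 - 1 / 3 * (α * e.e12 * e.e32) +
    α * e.e12 * e.e12 * e.e12 * (1 / 30 * α + 1 / 180 * e.e11)
  e56 := e.e56 + 1 / 360 * (α * e.e12 * e.e12 * e.e12 * e.e12)

/-- The coefficients after surrounding a symmetric scheme by two factors `exp(β h Y)`. -/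
noncomputable def OrderCoeffs.stepY (β : ℝ) (e : OrderCoeffs) : OrderCoeffs :=
  (e.swap.stepX β).swap

/-- The coefficients after surrounding a symmetric scheme by a stage on both sides. -/
noncomputable def OrderCoeffs.step (s : Stage) (e : OrderCoeffs) : OrderCoeffs :=
  if s.1 then e.stepX s.2.1 else e.stepY s.2.1

section Expansion

variable {A : Type*} [Ring A] [Algebra ℝ A]

/-- The exponent of a stage with the force gradients. -/
noncomputable def stageExponent (X Y Z : A) (c : ℝ) (s : Stage) : PowerSeries A :=
  if s.1 then oddSeries (s.2.1 • X) 0 (-(s.2.2 • Z))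
  else oddSeries (s.2.1 • Y) (-((s.2.1 * c) • commC X Y)) (-(s.2.2 • Z))

/-- The term of order five of the exponent of a symmetric scheme. -/
noncomputable def quintic (e : OrderCoeffs) (X Y : A) : A :=
  e.e51 • ⁅X, ⁅X, commC X Y⁆⁆ + e.e52 • ⁅X, ⁅X, commD X Y⁆⁆ + e.e53 • ⁅X, ⁅Y, commD X Y⁆⁆ +
    e.e54 • ⁅Y, ⁅X, commC X Y⁆⁆ + e.e55 • ⁅Y, ⁅Y, commC X Y⁆⁆ + e.e56 • ⁅Y, ⁅Y, commD X Y⁆⁆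

/-- The exponent of a symmetric scheme whose stages carry the force gradients. -/
noncomputable def gradientExponent (e : OrderCoeffs) (X Y Z : A) (c ω : ℝ) : PowerSeries A :=
  oddSeries (e.e11 • X + e.e12 • Y)
    -- The terms with c are the derivative of the plain exponent at Y in the direction -c h² C; the
    -- factor h² moves each of them up by two orders.
    (e.e31 • commC X Y + e.e32 • commD X Y - (c * e.e12) • commC X Y)
    (quintic e X Y - c • (e.e31 • ⁅X, ⁅X, commC X Y⁆⁆ +
      e.e32 • (⁅commC X Y, ⁅X, Y⁆⁆ + ⁅Y, ⁅X, commC X Y⁆⁆)) - ω • Z)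

set_option linter.unusedSectionVars false in
-- By Jacobi the difference is [[Y,X],[X,Y]] = 0. Together with the next two identities it brings
-- all quintic brackets to a normal form.
theorem lie_swap_commC (X Y : A) : ⁅Y, ⁅X, ⁅X, Y⁆⁆⁆ = ⁅X, ⁅Y, ⁅X, Y⁆⁆⁆ := by
  simp only [Ring.lie_def]; noncomm_ring

set_option linter.unusedSectionVars false in
theorem lie_commC_lie (X Y : A) :
    ⁅⁅X, ⁅X, Y⁆⁆, ⁅X, Y⁆⁆ = ⁅Y, ⁅X, ⁅X, ⁅X, Y⁆⁆⁆⁆ - ⁅X, ⁅X, ⁅Y, ⁅X, Y⁆⁆⁆⁆ := by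
  rw [← lie_skew, lie_lie X Y, lie_swap_commC]; abel

set_option linter.unusedSectionVars false in
theorem lie_commD_lie (X Y : A) :
    ⁅⁅Y, ⁅X, Y⁆⁆, ⁅X, Y⁆⁆ = ⁅Y, ⁅X, ⁅Y, ⁅X, Y⁆⁆⁆⁆ - ⁅X, ⁅Y, ⁅Y, ⁅X, Y⁆⁆⁆⁆ := by
  rw [← lie_skew, lie_lie X Y]; abel

theorem oddSeries_congr {w₁ w₃ w₅ w₁' w₃' w₅' : A} (h₁ : w₁ = w₁') (h₃ : w₃ = w₃')
    (h₅ : w₅ = w₅') : EqUpToSix (seriesExp (oddSeries w₁ w₃ w₅))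
      (seriesExp (oddSeries w₁' w₃' w₅')) := by
  subst h₁ h₃ h₅; exact .refl _

theorem eqUpToSix_stepX (e : OrderCoeffs) (X Y Z : A) (c ω α ζ : ℝ) :
    EqUpToSix
      (seriesExp (stageExponent X Y Z c (true, α, ζ)) * seriesExp (gradientExponent e X Y Z c ω) *
        seriesExp (stageExponent X Y Z c (true, α, ζ)))
      (seriesExp (gradientExponent (e.stepX α) X Y Z c (2 * ζ + ω))) := by
  refine (seriesExp_sandwich _ _ _ _ _ _).trans (oddSeries_congr ?_ ?_ ?_)
  · simp only [OrderCoeffs.stepX]; module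
  · simp only [OrderCoeffs.stepX, commC, commD, lie_add, add_lie, lie_smul, smul_lie, lie_self,
      smul_zero, zero_add]
    module
  · simp only [OrderCoeffs.stepX, quintic, commC, commD, lie_add, add_lie, lie_smul, smul_lie,
      lie_self, lie_sub, sub_lie, smul_zero, zero_add, add_zero, lie_swap_commC, lie_commC_lie,
      lie_commD_lie, zero_lie, lie_zero, smul_add, smul_sub, smul_smul]
    module

theorem eqUpToSix_stepY (e : OrderCoeffs) (X Y Z : A) (c ω β ζ : ℝ) :
    EqUpToSix
      (seriesExp (stageExponent X Y Z c (false, β, ζ)) *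
        seriesExp (gradientExponent e X Y Z c ω) *
        seriesExp (stageExponent X Y Z c (false, β, ζ)))
      (seriesExp (gradientExponent (e.stepY β) X Y Z c (2 * ζ + ω))) := by
  have hYX : ⁅Y, X⁆ = -⁅X, Y⁆ := (lie_skew Y X).symm
  have hCX : ⁅⁅X, ⁅X, Y⁆⁆, X⁆ = -⁅X, ⁅X, ⁅X, Y⁆⁆⁆ := (lie_skew _ _).symm
  have hCY : ⁅⁅X, ⁅X, Y⁆⁆, Y⁆ = -⁅X, ⁅Y, ⁅X, Y⁆⁆⁆ := by rw [← lie_swap_commC, lie_skew]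
  refine (seriesExp_sandwich _ _ _ _ _ _).trans (oddSeries_congr ?_ ?_ ?_)
  · simp only [OrderCoeffs.stepX, OrderCoeffs.stepY, OrderCoeffs.swap]; module
  · simp only [OrderCoeffs.stepX, OrderCoeffs.stepY, OrderCoeffs.swap, commC, commD, lie_add,
      add_lie, lie_smul, smul_lie, lie_self, hYX, lie_neg,
      smul_zero, add_zero]
    module
  · simp only [OrderCoeffs.stepX, OrderCoeffs.stepY, OrderCoeffs.swap, quintic, commC, commD,
      lie_add, add_lie, lie_smul, smul_lie, hYX, lie_neg, neg_lie, hCX, hCY,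
      lie_self, lie_sub, sub_lie, smul_zero, add_zero, lie_swap_commC, lie_commC_lie,
      lie_commD_lie, smul_add, smul_sub, smul_smul, smul_neg]
    module

theorem eqUpToSix_step (e : OrderCoeffs) (X Y Z : A) (c ω : ℝ) (s : Stage) :
    EqUpToSix
      (seriesExp (stageExponent X Y Z c s) * seriesExp (gradientExponent e X Y Z c ω) *
        seriesExp (stageExponent X Y Z c s))
      (seriesExp (gradientExponent (e.step s) X Y Z c (2 * s.2.2 + ω))) := by
  obtain ⟨i, t, ζ⟩ := s
  cases i
  · exact eqUpToSix_stepY e X Y Z c ω t ζ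
  · exact eqUpToSix_stepX e X Y Z c ω t ζ

end Expansion

/-- In every algebra, the product of the stages `l` has the order coefficients `e`. -/
def HasExpansion (l : List Stage) (e : OrderCoeffs) : Prop :=
  ∀ (A : Type) [Ring A] [Algebra ℝ A] (X Y Z : A) (c : ℝ),
    EqUpToSix (l.map fun s => seriesExp (stageExponent X Y Z c s)).prod
      (seriesExp (gradientExponent e X Y Z c (l.map fun s => s.2.2).sum))

theorem seriesExp_oddSeries_zero {A : Type*} [Ring A] [Algebra ℝ A] :
    seriesExp (oddSeries (0 : A) 0 0) = 1 := by
  have h : oddSeries (0 : A) 0 0 = 0 := by simp [oddSeries]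
  rw [h]
  ext N
  simp only [seriesExp, PowerSeries.coeff_mk]
  rw [Finset.sum_eq_single 0]
  · simp
  · intro k _ hk; simp [zero_pow hk]
  · simp

theorem hasExpansion_nil : HasExpansion [] ⟨0, 0, 0, 0, 0, 0, 0, 0, 0, 0⟩ := by
  intro A _ _ X Y Z c
  simp only [List.map_nil, List.prod_nil, List.sum_nil]
  rw [← seriesExp_oddSeries_zero]
  exact oddSeries_congr (by simp) (by simp) (by simp [quintic])

theorem hasExpansion_singleton (s : Stage) : HasExpansion [s]
    (if s.1 then ⟨s.2.1, 0, 0, 0, 0, 0, 0, 0, 0, 0⟩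
      else ⟨0, s.2.1, 0, 0, 0, 0, 0, 0, 0, 0⟩) := by
  intro A _ _ X Y Z c
  obtain ⟨i, t, ζ⟩ := s
  cases i <;> simp only [List.map_cons, List.map_nil, List.prod_singleton, List.sum_singleton] <;>
    exact oddSeries_congr (by simp) (by simp [mul_comm]) (by simp [quintic])

theorem HasExpansion.cons_concat {l : List Stage} {e : OrderCoeffs} (h : HasExpansion l e)
    (s : Stage) : HasExpansion (s :: (l ++ [s])) (e.step s) := by
  intro A _ _ X Y Z c
  simp only [List.map_cons, List.map_append, List.map_nil, List.prod_cons, List.prod_append,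
    List.prod_nil, mul_one, List.sum_cons, List.sum_append, List.sum_nil, add_zero, ← mul_assoc]
  have h' := ((EqUpToSix.refl (seriesExp (stageExponent X Y Z c s))).mul (h A X Y Z c)).mul
    (.refl (seriesExp (stageExponent X Y Z c s)))
  refine (h'.trans (eqUpToSix_step e X Y Z c _ s)).trans ?_
  rw [show 2 * s.2.2 + (l.map fun s => s.2.2).sum =
    s.2.2 + ((l.map fun s => s.2.2).sum + s.2.2) by ring]
  exact .refl _

theorem exists_hasExpansion {l : List Stage} (h : l.Palindrome) : ∃ e, HasExpansion l e := by
  induction h with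
  | nil => exact ⟨_, hasExpansion_nil⟩
  | singleton s => exact ⟨_, hasExpansion_singleton s⟩
  | cons_concat s _ ih => obtain ⟨e, he⟩ := ih; exact ⟨_, he.cons_concat s⟩

end Palindromes

/-! ### Linear independence of the brackets in the free algebra -/

section Uniqueness

/-- The coefficient of a word in an element of the free algebra. -/
noncomputable def wordCoeff (w : List (Fin 2)) (x : FreeAlg) : ℝ :=
  (FreeAlgebra.equivMonoidAlgebraFreeMonoid x).coeff (FreeMonoid.ofList w)

theorem equivMonoidAlgebra_genX : FreeAlgebra.equivMonoidAlgebraFreeMonoid genX =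
    MonoidAlgebra.single (FreeMonoid.ofList [0]) (1 : ℝ) := by
  simp [genX, FreeAlgebra.equivMonoidAlgebraFreeMonoid]

theorem equivMonoidAlgebra_genY : FreeAlgebra.equivMonoidAlgebraFreeMonoid genY =
    MonoidAlgebra.single (FreeMonoid.ofList [1]) (1 : ℝ) := by
  simp [genY, FreeAlgebra.equivMonoidAlgebraFreeMonoid]

theorem wordCoeff_add (w : List (Fin 2)) (x y : FreeAlg) :
    wordCoeff w (x + y) = wordCoeff w x + wordCoeff w y := by simp [wordCoeff]

theorem wordCoeff_sub (w : List (Fin 2)) (x y : FreeAlg) :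
    wordCoeff w (x - y) = wordCoeff w x - wordCoeff w y := by simp [wordCoeff]

theorem wordCoeff_smul (w : List (Fin 2)) (t : ℝ) (x : FreeAlg) :
    wordCoeff w (t • x) = t * wordCoeff w x := by simp [wordCoeff]

/-- Stripping the first letter evaluates the coefficient of a word in an expanded bracket letter by
letter. -/
theorem coeff_single_ofList_mul (i j : Fin 2) (w : List (Fin 2))
    (x : MonoidAlgebra ℝ (FreeMonoid (Fin 2))) :
    (MonoidAlgebra.single (FreeMonoid.ofList [i]) (1 : ℝ) * x).coeff
      (FreeMonoid.ofList (j :: w)) = if i = j then x.coeff (FreeMonoid.ofList w) else 0 := by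
  split_ifs with h
  · rw [MonoidAlgebra.coeff_single_mul_eq_mul_coeff (FreeMonoid.ofList w), one_mul]
    intro m _
    subst h
    exact ⟨fun h => (List.cons.inj h).2, fun h => by rw [h]; rfl⟩
  · exact MonoidAlgebra.coeff_single_mul_of_forall_mul_ne _ _
      fun d hd => h (List.cons.inj hd).1

theorem wordCoeff_cons_genX_mul (i : Fin 2) (w : List (Fin 2)) (x : FreeAlg) :
    wordCoeff (i :: w) (genX * x) = if 0 = i then wordCoeff w x else 0 := by
  rw [wordCoeff, map_mul, equivMonoidAlgebra_genX, coeff_single_ofList_mul]; rfl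

theorem wordCoeff_cons_genY_mul (i : Fin 2) (w : List (Fin 2)) (x : FreeAlg) :
    wordCoeff (i :: w) (genY * x) = if 1 = i then wordCoeff w x else 0 := by
  rw [wordCoeff, map_mul, equivMonoidAlgebra_genY, coeff_single_ofList_mul]; rfl

theorem wordCoeff_nil_one : wordCoeff [] 1 = 1 := by
  simp [wordCoeff, MonoidAlgebra.one_def]

theorem wordCoeff_singleton_genX (i : Fin 2) : wordCoeff [i] genX = if 0 = i then 1 else 0 := by
  rw [← mul_one genX, wordCoeff_cons_genX_mul, wordCoeff_nil_one]

theorem wordCoeff_singleton_genY (i : Fin 2) : wordCoeff [i] genY = if 1 = i then 1 else 0 := by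
  rw [← mul_one genY, wordCoeff_cons_genY_mul, wordCoeff_nil_one]

theorem wordCoeff_zero (w : List (Fin 2)) : wordCoeff w 0 = 0 := by simp [wordCoeff]

theorem eq_zero_of_linear {p q : ℝ} (h : p • genX + q • genY = 0) : p = 0 ∧ q = 0 := by
  have hX := congrArg (wordCoeff [0]) h
  have hY := congrArg (wordCoeff [1]) h
  simp [wordCoeff_add, wordCoeff_smul, wordCoeff_zero, wordCoeff_singleton_genX,
    wordCoeff_singleton_genY] at hX hY
  exact ⟨hX, hY⟩

theorem eq_zero_of_cubic {p q : ℝ} (h : p • commC genX genY + q • commD genX genY = 0) :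
    p = 0 ∧ q = 0 := by
  have hX := congrArg (wordCoeff [0, 0, 1]) h
  have hY := congrArg (wordCoeff [0, 1, 1]) h
  simp [commC, commD, Ring.lie_def, mul_sub, sub_mul, mul_assoc, wordCoeff_add, wordCoeff_sub,
    wordCoeff_smul, wordCoeff_zero, wordCoeff_singleton_genX,
    wordCoeff_singleton_genY, wordCoeff_cons_genX_mul, wordCoeff_cons_genY_mul] at hX hY
  exact ⟨hX, hY⟩

theorem eq_zero_of_quintic {e : OrderCoeffs} (h : quintic e genX genY = 0) :
    e.e51 = 0 ∧ e.e52 = 0 ∧ e.e53 = 0 ∧ e.e54 = 0 ∧ e.e55 = 0 ∧ e.e56 = 0 := by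
  simp only [quintic, commC, commD, Ring.lie_def, mul_sub, sub_mul, mul_assoc] at h
  -- At these six words the brackets have coefficients that form a nonsingular linear system.
  have h₁ := congrArg (wordCoeff [0, 0, 0, 0, 1]) h
  have h₂ := congrArg (wordCoeff [0, 0, 0, 1, 1]) h
  have h₃ := congrArg (wordCoeff [0, 1, 1, 1, 0]) h
  have h₄ := congrArg (wordCoeff [1, 0, 0, 0, 1]) h
  have h₅ := congrArg (wordCoeff [1, 1, 1, 0, 0]) h
  have h₆ := congrArg (wordCoeff [1, 1, 1, 1, 0]) h
  clear h
  simp only [wordCoeff_add, wordCoeff_sub, wordCoeff_smul, wordCoeff_zero,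
    wordCoeff_singleton_genX, wordCoeff_singleton_genY, wordCoeff_cons_genX_mul,
    wordCoeff_cons_genY_mul, if_true, zero_ne_one, one_ne_zero, if_false]
    at h₁ h₂ h₃ h₄ h₅ h₆
  refine ⟨?_, ?_, ?_, ?_, ?_, ?_⟩ <;> linarith

theorem formalExponent_eq_oddSeries (e : OrderCoeffs) : formalExponent e =
    oddSeries (e.e11 • genX + e.e12 • genY)
      (e.e31 • commC genX genY + e.e32 • commD genX genY) (quintic e genX genY) := rfl

/-- At each odd order the exponential contains the exponent's own term plus products of terms of
lower order, so comparing orders one, three, five in turn isolates combinations of independent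
brackets. -/
theorem IsOrderExpansion.unique {m : ℕ} {a b : Fin m → ℝ} {e e' : OrderCoeffs}
    (h : IsOrderExpansion a b e) (h' : IsOrderExpansion a b e') : e = e' := by
  have key : ∀ N < 7, PowerSeries.coeff N (seriesExp (formalExponent e)) =
      PowerSeries.coeff N (seriesExp (formalExponent e')) :=
    fun N hN => (h N hN).symm.trans (h' N hN)
  simp only [formalExponent_eq_oddSeries] at key
  have k₁ := key 1 (by norm_num)
  have k₃ := key 3 (by norm_num)
  have k₅ := key 5 (by norm_num)
  simp only [coeff_one_seriesExp_oddSeries] at k₁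
  simp only [coeff_three_seriesExp_oddSeries, k₁, add_left_inj] at k₃
  simp only [coeff_five_seriesExp_oddSeries, k₁, k₃, add_left_inj] at k₅
  obtain ⟨h11, h12⟩ := eq_zero_of_linear (p := e.e11 - e'.e11) (q := e.e12 - e'.e12)
    (by rw [← sub_eq_zero] at k₁; rw [← k₁]; module)
  obtain ⟨h31, h32⟩ := eq_zero_of_cubic (p := e.e31 - e'.e31) (q := e.e32 - e'.e32)
    (by rw [← sub_eq_zero] at k₃; rw [← k₃]; module)
  obtain ⟨h51, h52, h53, h54, h55, h56⟩ := eq_zero_of_quintic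
    (e := ⟨0, 0, 0, 0, e.e51 - e'.e51, e.e52 - e'.e52, e.e53 - e'.e53, e.e54 - e'.e54,
      e.e55 - e'.e55, e.e56 - e'.e56⟩)
    (by rw [← sub_eq_zero] at k₅; rw [← k₅]; simp only [quintic]; module)
  ext <;> exact sub_eq_zero.1 (by assumption)

theorem IsOrderExpansion.orderCoeffs_eq {m : ℕ} {a b : Fin m → ℝ} {e : OrderCoeffs}
    (h : IsOrderExpansion a b e) : orderCoeffs a b = e :=
  (Classical.epsilon_spec (p := IsOrderExpansion a b) ⟨e, h⟩).unique h

end Uniqueness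

/-! ### Class symmetry as palindromicity of the stages -/

section Symmetry

/-- The palindromic list of stages of a symmetric scheme: its product, in any monoid, is that of the
scheme, provided that trivial stages are interpreted by `1`. -/
def IsStageList {m : ℕ} (a b ζ₁ ζ₂ : Fin m → ℝ) (l : List Stage) : Prop :=
  ∀ (M : Type) [Monoid M] (F : Stage → M), F (true, 0, 0) = 1 → F (false, 0, 0) = 1 →
    (List.ofFn fun j => F (true, a j, ζ₁ j) * F (false, b j, ζ₂ j)).prod = (l.map F).prod

/-- The stages, numbered from zero. -/
noncomputable def stageAt {m : ℕ} (a b ζ₁ ζ₂ : Fin m → ℝ) (k : ℕ) : Stage :=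
  if h : k / 2 < m then
    if k % 2 = 0 then (true, a ⟨k / 2, h⟩, ζ₁ ⟨k / 2, h⟩) else (false, b ⟨k / 2, h⟩, ζ₂ ⟨k / 2, h⟩)
  else (true, 0, 0)

theorem prod_ofFn_mul {M : Type*} [Monoid M] (f : ℕ → M) (m : ℕ) :
    (List.ofFn fun j : Fin m => f (2 * j) * f (2 * j + 1)).prod =
      ((List.range (2 * m)).map f).prod := by
  induction m with
  | zero => simp
  | succ m ih =>
    rw [List.ofFn_succ', List.concat_eq_append, List.prod_append, Nat.mul_succ, List.range_succ,
      List.range_succ]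
    simp only [List.map_append, List.prod_append, ← ih]
    simp [mul_assoc]

theorem isStageList_range {m : ℕ} (a b ζ₁ ζ₂ : Fin m → ℝ) :
    IsStageList a b ζ₁ ζ₂ ((List.range (2 * m)).map (stageAt a b ζ₁ ζ₂)) := by
  intro M _ F _ _
  rw [List.map_map, ← prod_ofFn_mul]
  congr 2
  funext j
  have h₁ : 2 * (j : ℕ) / 2 = j := by omega
  have h₂ : (2 * (j : ℕ) + 1) / 2 = j := by omega
  have h₃ : (2 * (j : ℕ) + 1) % 2 = 1 := by omega
  simp [stageAt, h₁, h₂, h₃, j.2]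

theorem palindrome_map_range {α : Type*} (f : ℕ → α) (n : ℕ)
    (h : ∀ i j, i + j + 1 = n → f i = f j) : ((List.range n).map f).Palindrome := by
  apply List.Palindrome.of_reverse_eq
  apply List.ext_getElem
  · simp
  · intro i h₁ h₂
    simp only [List.length_reverse, List.length_map, List.length_range] at h₁ h₂
    simp only [List.getElem_reverse, List.getElem_map, List.getElem_range, List.length_map,
      List.length_range]
    exact h _ _ (by omega)

theorem IsClassA.exists_palindrome {m : ℕ} {a b ζ₁ ζ₂ : Fin m → ℝ} (h : IsClassA a b)
    (hζ : IsClassA ζ₁ ζ₂) : ∃ l : List Stage, l.Palindrome ∧ IsStageList a b ζ₁ ζ₂ l := by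
  obtain ⟨ha, hb, hb'⟩ := h
  obtain ⟨hz, hw, hw'⟩ := hζ
  -- The last stage is trivial and is dropped. Mirrored indices then add up to 2m - 2, so they have
  -- the same parity and belong to the same subproblem.
  refine ⟨(List.range (2 * m - 1)).map (stageAt a b ζ₁ ζ₂), palindrome_map_range _ _ ?_, ?_⟩
  · intro i j hij
    have hi : i / 2 < m := by omega
    have hj : j / 2 < m := by omega
    simp only [stageAt, hi, hj, dif_pos]
    rcases Nat.mod_two_eq_zero_or_one i with hi' | hi'
    · have hj' : j % 2 = 0 := by omega
      simp only [hi', hj', if_true]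
      rw [ha ⟨i / 2, hi⟩ ⟨j / 2, hj⟩ (by simp only; omega),
        hz ⟨i / 2, hi⟩ ⟨j / 2, hj⟩ (by simp only; omega)]
    · have hj' : j % 2 = 1 := by omega
      simp only [hi', hj', one_ne_zero, if_false]
      rw [hb' ⟨i / 2, hi⟩ ⟨j / 2, hj⟩ (by simp only; omega),
        hw' ⟨i / 2, hi⟩ ⟨j / 2, hj⟩ (by simp only; omega)]
  · intro M _ F h₁ h₂
    rw [isStageList_range a b ζ₁ ζ₂ M F h₁ h₂]
    cases m with
    | zero => simp
    | succ m =>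
      rw [show 2 * (m + 1) = 2 * m + 1 + 1 by ring, List.range_succ, Nat.add_sub_cancel]
      have h₃ : (2 * m + 1) / 2 = m := by omega
      have h₄ : (2 * m + 1) % 2 = 1 := by omega
      simp [stageAt, h₃, h₄, hb ⟨m, Nat.lt_succ_self m⟩ rfl, hw ⟨m, Nat.lt_succ_self m⟩ rfl, h₂]

theorem IsClassB.exists_palindrome {m : ℕ} {a b ζ₁ ζ₂ : Fin m → ℝ} (h : IsClassB a b)
    (hζ : IsClassB ζ₁ ζ₂) : ∃ l : List Stage, l.Palindrome ∧ IsStageList a b ζ₁ ζ₂ l := by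
  obtain ⟨ha, ha', hb⟩ := h
  obtain ⟨hz, hz', hw⟩ := hζ
  -- Here the trivial stage is the first one, hence the shift by one.
  refine ⟨(List.range (2 * m - 1)).map fun k => stageAt a b ζ₁ ζ₂ (k + 1),
    palindrome_map_range _ _ ?_, ?_⟩
  · intro i j hij
    have hi : (i + 1) / 2 < m := by omega
    have hj : (j + 1) / 2 < m := by omega
    simp only [stageAt, hi, hj, dif_pos]
    rcases Nat.mod_two_eq_zero_or_one (i + 1) with hi' | hi'
    · have hj' : (j + 1) % 2 = 0 := by omega
      simp only [hi', hj', if_true]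
      rw [ha' ⟨(i + 1) / 2, hi⟩ ⟨(j + 1) / 2, hj⟩ (by simp only; omega),
        hz' ⟨(i + 1) / 2, hi⟩ ⟨(j + 1) / 2, hj⟩ (by simp only; omega)]
    · have hj' : (j + 1) % 2 = 1 := by omega
      simp only [hi', hj', one_ne_zero, if_false]
      rw [hb ⟨(i + 1) / 2, hi⟩ ⟨(j + 1) / 2, hj⟩ (by simp only; omega),
        hw ⟨(i + 1) / 2, hi⟩ ⟨(j + 1) / 2, hj⟩ (by simp only; omega)]
  · intro M _ F h₁ h₂
    rw [isStageList_range a b ζ₁ ζ₂ M F h₁ h₂]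
    cases m with
    | zero => simp
    | succ m =>
      rw [show 2 * (m + 1) = 2 * m + 1 + 1 by ring, List.range_succ_eq_map, Nat.add_sub_cancel]
      have h₃ : stageAt a b ζ₁ ζ₂ 0 = (true, 0, 0) := by
        simp [stageAt, ha 0 rfl, hz 0 rfl]
      simp only [List.map_cons, List.prod_cons, h₃, h₁, one_mul, List.map_map]
      rfl

theorem HasExpansion.isOrderExpansion {m : ℕ} {a b ζ₁ ζ₂ : Fin m → ℝ} {l : List Stage}
    {e : OrderCoeffs} (h : HasExpansion l e) (hl : IsStageList a b ζ₁ ζ₂ l) :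
    IsOrderExpansion a b e := by
  -- With Z = 0 and c = 0 the gradients disappear and the plain splitting product is left.
  have h' := h FreeAlg genX genY 0 0
  rw [← hl (PowerSeries FreeAlg)
    (fun s => seriesExp (stageExponent genX genY 0 0 s))
    (by simp [stageExponent, seriesExp_oddSeries_zero])
    (by simp [stageExponent, seriesExp_oddSeries_zero])] at h'
  have h₁ : gradientExponent e genX genY 0 0 (l.map fun s => s.2.2).sum = formalExponent e := by
    simp [gradientExponent, formalExponent_eq_oddSeries]
  have h₂ : (List.ofFn fun j =>
      seriesExp (stageExponent genX genY 0 0 (true, a j, ζ₁ j)) *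
        seriesExp (stageExponent genX genY 0 0 (false, b j, ζ₂ j))).prod = formalProduct a b := by
    simp only [formalProduct, stageExponent, formalExp_eq_seriesExp, monomial_one_eq_oddSeries,
      smul_zero, neg_zero, mul_zero, zero_smul, if_true, Bool.false_eq_true, if_false]
  rw [h₁, h₂] at h'
  exact h'

theorem existsUnique_isOrderExpansion {m : ℕ} {a b : Fin m → ℝ}
    (h : IsClassA a b ∨ IsClassB a b) : ∃! e, IsOrderExpansion a b e := by
  -- The weights play no role here; (a, b) itself is a choice with the right symmetry.
  obtain ⟨l, hp, hl⟩ : ∃ l : List Stage, l.Palindrome ∧ IsStageList a b a b l :=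
    h.elim (fun h => h.exists_palindrome h) (fun h => h.exists_palindrome h)
  obtain ⟨e, he⟩ := exists_hasExpansion hp
  exact ⟨e, he.isOrderExpansion hl, fun e' h' => h'.unique (he.isOrderExpansion hl)⟩

theorem IsStageList.sum_weights {m : ℕ} {a b ζ₁ ζ₂ : Fin m → ℝ} {l : List Stage}
    (hl : IsStageList a b ζ₁ ζ₂ l) :
    (l.map fun s => s.2.2).sum = ∑ j, (ζ₁ j + ζ₂ j) := by
  -- In this monoid the product of the stages is the sum of their weights.
  have h := hl (Multiplicative ℝ) (fun s => Multiplicative.ofAdd s.2.2) rfl rfl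
  have h' := congrArg Multiplicative.toAdd h
  simpa [List.prod_ofFn, toAdd_list_sum, Function.comp_def] using h'.symm

end Symmetry

/-! ### From formal series to expansions of functions as h → 0 -/

section Jets

set_option linter.unusedSectionVars false

variable {A : Type*} [NormedRing A] [NormedAlgebra ℝ A]

/-- The sum of the terms of a power series up to order six. -/
noncomputable def jetSum (P : PowerSeries A) (h : ℝ) : A :=
  ∑ N ∈ Finset.range 7, h ^ N • PowerSeries.coeff N P

/-- The function `F` has the expansion `P` at zero, up to terms of order seven. -/
def HasJet (F : ℝ → A) (P : PowerSeries A) : Prop :=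
  (fun h => F h - jetSum P h) =O[𝓝 0] fun h : ℝ => h ^ 7

theorem continuous_jetSum (P : PowerSeries A) : Continuous (jetSum P) := by
  unfold jetSum; fun_prop

theorem isBigO_one_of_continuous {F : ℝ → A} (hF : Continuous F) :
    F =O[𝓝 0] fun _ : ℝ => (1 : ℝ) :=
  hF.continuousAt.tendsto.isBigO_one ℝ

theorem HasJet.isBigO_one {F : ℝ → A} {P : PowerSeries A} (hF : HasJet F P) :
    F =O[𝓝 0] fun _ : ℝ => (1 : ℝ) := by
  have h₁ : (fun h : ℝ => h ^ 7) =O[𝓝 0] fun _ : ℝ => (1 : ℝ) :=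
    (continuous_pow 7).continuousAt.tendsto.isBigO_one ℝ
  have := (IsBigO.trans hF h₁).add (isBigO_one_of_continuous (continuous_jetSum P))
  simpa using this

theorem jetSum_mul (P Q : PowerSeries A) :
    (fun h => jetSum P h * jetSum Q h - jetSum (P * Q) h) =O[𝓝 0] fun h : ℝ => h ^ 7 := by
  -- Only pairs of total order at least seven survive, and each of them is O(h⁷).
  have h₁ : ∀ h : ℝ, jetSum P h * jetSum Q h - jetSum (P * Q) h =
      ∑ x ∈ (Finset.range 7 ×ˢ Finset.range 7).filter fun x => ¬ x.1 + x.2 < 7,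
        h ^ (x.1 + x.2) • (PowerSeries.coeff x.1 P * PowerSeries.coeff x.2 Q) := by
    intro h
    have h₂ : jetSum P h * jetSum Q h = ∑ x ∈ Finset.range 7 ×ˢ Finset.range 7,
        h ^ (x.1 + x.2) • (PowerSeries.coeff x.1 P * PowerSeries.coeff x.2 Q) := by
      rw [jetSum, jetSum, Finset.sum_mul_sum, Finset.sum_product]
      refine Finset.sum_congr rfl fun i _ => Finset.sum_congr rfl fun j _ => ?_
      rw [smul_mul_smul_comm, pow_add]
    have h₃ : jetSum (P * Q) h =
        ∑ x ∈ (Finset.range 7 ×ˢ Finset.range 7).filter fun x => x.1 + x.2 < 7,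
          h ^ (x.1 + x.2) • (PowerSeries.coeff x.1 P * PowerSeries.coeff x.2 Q) := by
      rw [jetSum, ← Finset.sum_fiberwise_of_maps_to (t := Finset.range 7)
        (g := fun x : ℕ × ℕ => x.1 + x.2) (by simp)]
      refine Finset.sum_congr rfl fun N hN => ?_
      rw [PowerSeries.coeff_mul, Finset.smul_sum]
      refine Finset.sum_congr ?_ fun x hx => ?_
      · ext x
        simp only [Finset.mem_filter, Finset.mem_product, Finset.mem_range,
          Finset.HasAntidiagonal.mem_antidiagonal] at hN ⊢
        omega
      · rw [(Finset.mem_filter.1 hx).2]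
    rw [h₂, h₃, sub_eq_iff_eq_add, add_comm, Finset.sum_filter_add_sum_filter_not]
  simp_rw [h₁]
  refine IsBigO.fun_sum fun x hx => ?_
  simp only [Finset.mem_filter, not_lt] at hx
  have h₂ : (fun h : ℝ => h ^ (x.1 + x.2)) =O[𝓝 0] fun h : ℝ => h ^ 7 := by
    refine IsBigO.of_bound 1 ?_
    filter_upwards [Metric.ball_mem_nhds (0 : ℝ) one_pos] with h hh
    rw [one_mul, norm_pow, norm_pow]
    exact pow_le_pow_of_le_one (norm_nonneg _) (mem_ball_zero_iff.1 hh).le hx.2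
  simpa using h₂.smul (isBigO_refl
    (fun _ : ℝ => PowerSeries.coeff x.1 P * PowerSeries.coeff x.2 Q) (𝓝 0) |>.trans
      (isBigO_const_const _ (one_ne_zero (α := ℝ)) _))

theorem HasJet.mul {F G : ℝ → A} {P Q : PowerSeries A} (hF : HasJet F P) (hG : HasJet G Q) :
    HasJet (fun h => F h * G h) (P * Q) := by
  have h₁ := IsBigO.mul hF hG.isBigO_one
  have h₂ := (isBigO_one_of_continuous (continuous_jetSum P)).mul hG
  have h₃ := (h₁.congr_right (fun h => mul_one _)).add (h₂.congr_right fun h => one_mul _)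
  refine (h₃.add (jetSum_mul P Q)).congr_left fun h => ?_
  noncomm_ring

theorem jetSum_one (h : ℝ) : jetSum (1 : PowerSeries A) h = 1 := by
  simp [jetSum, PowerSeries.coeff_one]

theorem hasJet_one : HasJet (fun _ => (1 : A)) 1 := by
  simp only [HasJet, jetSum_one, sub_self]; exact isBigO_zero _ _

theorem HasJet.pow {F : ℝ → A} {P : PowerSeries A} (hF : HasJet F P) (k : ℕ) :
    HasJet (fun h => F h ^ k) (P ^ k) := by
  induction k with
  | zero => simpa using hasJet_one
  | succ k ih => simpa only [pow_succ] using ih.mul hF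

theorem HasJet.list_prod {ι : Type*} {F : ι → ℝ → A} {P : ι → PowerSeries A}
    (h : ∀ i, HasJet (F i) (P i)) (l : List ι) :
    HasJet (fun t => (l.map fun i => F i t).prod) (l.map P).prod := by
  induction l with
  | nil => simpa using hasJet_one
  | cons i l ih => simpa using (h i).mul ih

theorem HasJet.congr_series {F : ℝ → A} {P Q : PowerSeries A} (hF : HasJet F P)
    (hPQ : EqUpToSix P Q) : HasJet F Q := by
  have h : ∀ t, jetSum P t = jetSum Q t := fun t =>
    Finset.sum_congr rfl fun N hN => by rw [hPQ N (Finset.mem_range.1 hN)]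
  simpa only [HasJet, h] using hF

theorem coeff_pow_oddSeries_of_lt (w₁ w₃ w₅ : A) {k N : ℕ} (h : N < k) :
    PowerSeries.coeff N (oddSeries w₁ w₃ w₅ ^ k) = 0 := by
  induction k generalizing N with
  | zero => omega
  | succ k ih =>
    rw [pow_succ, PowerSeries.coeff_mul]
    refine Finset.sum_eq_zero fun x hx => ?_
    have hx' := Finset.HasAntidiagonal.mem_antidiagonal.1 hx
    rcases Nat.eq_zero_or_pos x.2 with h₀ | h₀
    · rw [h₀, coeff_oddSeries]; simp
    · rw [ih (by omega), zero_mul]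

theorem jetSum_oddSeries (w₁ w₃ w₅ : A) (h : ℝ) :
    jetSum (oddSeries w₁ w₃ w₅) h = h • w₁ + h ^ 3 • w₃ + h ^ 5 • w₅ := by
  simp [jetSum, Finset.sum_range_succ, coeff_oddSeries]

/-- The cut-off k ≤ N in `seriesExp` may be relaxed to k ≤ 6, since the k-th power has no terms
below order k. -/
theorem jetSum_seriesExp (w₁ w₃ w₅ : A) (h : ℝ) :
    jetSum (seriesExp (oddSeries w₁ w₃ w₅)) h =
      ∑ k ∈ Finset.range 7, ((k.factorial : ℝ)⁻¹) • jetSum (oddSeries w₁ w₃ w₅ ^ k) h := by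
  simp only [jetSum, seriesExp, PowerSeries.coeff_mk, Finset.smul_sum]
  rw [Finset.sum_comm]
  refine Finset.sum_congr rfl fun N hN => ?_
  rw [Finset.mem_range] at hN
  rw [← Finset.sum_subset (s₁ := Finset.range (N + 1)) (s₂ := Finset.range 7)]
  · exact Finset.sum_congr rfl fun k _ => smul_comm _ _ _
  · intro k hk; simp only [Finset.mem_range] at hk ⊢; omega
  · intro k _ hk
    rw [coeff_pow_oddSeries_of_lt _ _ _ (by simpa using hk), smul_zero, smul_zero]

theorem hasJet_exp [CompleteSpace A] (w₁ w₃ w₅ : A) :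
    HasJet (fun h => NormedSpace.exp (h • w₁ + h ^ 3 • w₃ + h ^ 5 • w₅))
      (seriesExp (oddSeries w₁ w₃ w₅)) := by
  set B : ℝ → A := fun h => h • w₁ + h ^ 3 • w₃ + h ^ 5 • w₅ with hB
  have hBjet : HasJet B (oddSeries w₁ w₃ w₅) := by
    simp only [HasJet, jetSum_oddSeries, hB, sub_self]; exact isBigO_zero _ _
  have hB0 : Tendsto B (𝓝 0) (𝓝 0) := by
    have : Continuous B := by fun_prop
    simpa [hB] using this.tendsto 0
  have hBO : B =O[𝓝 0] fun h : ℝ => h := by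
    have h₁ : B = fun h : ℝ => h • (w₁ + h ^ 2 • w₃ + h ^ 4 • w₅) := by
      funext h; simp only [hB, smul_add, smul_smul]; congr 2 <;> ring_nf
    rw [h₁]
    have h₂ : Continuous fun h : ℝ => w₁ + h ^ 2 • w₃ + h ^ 4 • w₅ := by fun_prop
    simpa using (isBigO_refl (fun h : ℝ => h) (𝓝 0)).smul (isBigO_one_of_continuous h₂)
  have hexp : (fun h => NormedSpace.exp (B h) -
      ∑ k ∈ Finset.range 7, ((k.factorial : ℝ)⁻¹) • B h ^ k) =O[𝓝 0] fun h : ℝ => h ^ 7 := by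
    have h₁ := (NormedSpace.hasFPowerSeriesAt_exp_zero_of_radius_pos (𝕂 := ℝ) (𝔸 := A)
      (NormedSpace.expSeries_radius_pos ℝ A)).isBigO_sub_partialSum_pow 7
    have h₂ := (h₁.comp_tendsto hB0).trans ((hBO.norm_left.pow 7))
    refine h₂.congr_left fun h => ?_
    simp [FormalMultilinearSeries.partialSum, NormedSpace.expSeries_apply_eq]
  have hsum : (fun h => (∑ k ∈ Finset.range 7, ((k.factorial : ℝ)⁻¹) • B h ^ k) -
      jetSum (seriesExp (oddSeries w₁ w₃ w₅)) h) =O[𝓝 0] fun h : ℝ => h ^ 7 := by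
    simp only [jetSum_seriesExp, ← Finset.sum_sub_distrib, ← smul_sub]
    exact IsBigO.fun_sum fun k _ => IsBigO.const_smul_left (hBjet.pow k) ((k.factorial : ℝ)⁻¹)
  exact (hexp.add hsum).congr_left fun h => by abel

/-- Functions with the same expansion as `exp (h L)` are `exp (h L + O(h⁷))`. -/
theorem HasJet.exists_eq_exp [CompleteSpace A] {F : ℝ → A} {L : A}
    (hF : HasJet F (seriesExp (oddSeries L 0 0))) :
    ∃ E : ℝ → A, E =O[𝓝 0] (fun h : ℝ => h ^ 7) ∧
      ∀ᶠ h in 𝓝 (0 : ℝ), F h = NormedSpace.exp (h • L + E h) := by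
  have hL : HasJet (fun h : ℝ => NormedSpace.exp (h • L)) (seriesExp (oddSeries L 0 0)) := by
    simpa using hasJet_exp L 0 0
  have hdiff : (fun h => F h - NormedSpace.exp (h • L)) =O[𝓝 0] fun h : ℝ => h ^ 7 :=
    (IsBigO.sub hF hL).congr_left fun h => by abel
  -- The derivative of exp at 0 is the identity, so the inverse function theorem supplies a
  -- logarithm near 1.
  have hd : HasStrictFDerivAt (NormedSpace.exp : A → A)
      ((ContinuousLinearEquiv.refl ℝ A : A ≃L[ℝ] A) : A →L[ℝ] A) 0 :=
    hasStrictFDerivAt_exp_zero (𝕂 := ℝ)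
  set log := hd.localInverse _ _ _
  have hlin : Tendsto (fun h : ℝ => h • L) (𝓝 0) (𝓝 0) := by
    have : Continuous fun h : ℝ => h • L := by fun_prop
    simpa using this.tendsto 0
  have hexpL : Tendsto (fun h : ℝ => NormedSpace.exp (h • L)) (𝓝 0)
      (𝓝 (NormedSpace.exp (0 : A))) :=
    hd.continuousAt.tendsto.comp hlin
  have hF0 : Tendsto F (𝓝 0) (𝓝 (NormedSpace.exp (0 : A))) := by
    have h₁ : Tendsto (fun h => F h - NormedSpace.exp (h • L)) (𝓝 0) (𝓝 0) :=
      hdiff.trans_tendsto (by simpa using (continuous_pow 7).tendsto (0 : ℝ))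
    simpa using h₁.add hexpL
  refine ⟨fun h => log (F h) - h • L, ?_, ?_⟩
  -- The logarithm is Lipschitz near 1 and log exp(hL) = hL for small h, so the O(h⁷) distance of F
  -- to exp(hL) carries over to the exponents.
  · obtain ⟨K, s, hs, hK⟩ := hd.to_localInverse.exists_lipschitzOnWith
    refine IsBigO.trans (IsBigO.of_bound K ?_) hdiff
    filter_upwards [hF0 hs, hexpL hs, hlin.eventually hd.eventually_left_inverse]
      with h h₁ h₂ h₃
    have := hK.norm_sub_le h₁ h₂
    dsimp only at this
    rwa [h₃] at this
  · filter_upwards [hF0.eventually hd.eventually_right_inverse] with h h₁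
    rw [add_sub_cancel]
    exact h₁.symm

end Jets

section Matrices

variable {n : ℕ}

/-! ### Order six of the schemes -/

section Order

attribute [local instance] Matrix.linftyOpNormedRing Matrix.linftyOpNormedAlgebra

/-- One stage of the splitting scheme with force gradients. -/
noncomputable def stageMatrix (L₁ L₂ Z : Matrix (Fin n) (Fin n) ℝ) (c : ℝ) (s : Stage) (h : ℝ) :
    Matrix (Fin n) (Fin n) ℝ :=
  NormedSpace.exp (if s.1 then (s.2.1 * h) • L₁ - (s.2.2 * h ^ 5) • Z
    else (s.2.1 * h) • (L₂ - (c * h ^ 2) • commC L₁ L₂) - (s.2.2 * h ^ 5) • Z)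

theorem scheme_eq_prod {m : ℕ} (a b ζ₁ ζ₂ : Fin m → ℝ) (L₁ L₂ Z : Matrix (Fin n) (Fin n) ℝ)
    (h : ℝ) : scheme a b ζ₁ ζ₂ L₁ L₂ Z h = (List.ofFn fun j =>
      stageMatrix L₁ L₂ Z (orderCoeffs a b).e31 (true, a j, ζ₁ j) h *
        stageMatrix L₁ L₂ Z (orderCoeffs a b).e31 (false, b j, ζ₂ j) h).prod := by
  simp [scheme, stageMatrix]

theorem hasJet_stageMatrix (L₁ L₂ Z : Matrix (Fin n) (Fin n) ℝ) (c : ℝ) (s : Stage) :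
    HasJet (stageMatrix L₁ L₂ Z c s) (seriesExp (stageExponent L₁ L₂ Z c s)) := by
  obtain ⟨i, t, ζ⟩ := s
  cases i
  · refine Eq.mp ?_ (hasJet_exp (t • L₂) (-((t * c) • commC L₁ L₂)) (-(ζ • Z)))
    congr 1
    funext h
    simp only [stageMatrix, Bool.false_eq_true, if_false]
    congr 1
    module
  · refine Eq.mp ?_ (hasJet_exp (t • L₁) 0 (-(ζ • Z)))
    congr 1
    funext h
    simp only [stageMatrix, if_true]
    congr 1
    module

theorem HasJet.hasOrder {Φ : ℝ → Matrix (Fin n) (Fin n) ℝ} {L : Matrix (Fin n) (Fin n) ℝ}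
    (h : HasJet Φ (seriesExp (oddSeries L 0 0))) : HasOrder Φ L 6 := by
  obtain ⟨E, hE, hE'⟩ := h.exists_eq_exp
  refine ⟨E, fun i j => IsBigO.trans (IsBigO.of_bound 1 (Eventually.of_forall fun t => ?_)) hE,
    hE'⟩
  rw [one_mul]
  have h₁ : ‖E t i j‖ ≤ ∑ k, ‖E t i k‖ :=
    Finset.single_le_sum (f := fun k => ‖E t i k‖) (fun _ _ => norm_nonneg _) (Finset.mem_univ j)
  -- The norm in use is the maximal row sum, which dominates each entry.
  have h₂ : (∑ k, ‖E t i k‖₊) ≤ ‖E t‖₊ := by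
    rw [Matrix.linfty_opNNNorm_def]
    exact Finset.le_sup (f := fun i => ∑ k, ‖E t i k‖₊) (Finset.mem_univ i)
  refine h₁.trans ?_
  simpa only [NNReal.coe_sum, coe_nnnorm] using NNReal.coe_le_coe.2 h₂

theorem scheme_hasOrder {m : ℕ} {a b ζ₁ ζ₂ : Fin m → ℝ} {l : List Stage} (hp : l.Palindrome)
    (hl : IsStageList a b ζ₁ ζ₂ l) (hζ : ∑ j, (ζ₁ j + ζ₂ j) = 1)
    (h11 : (orderCoeffs a b).e11 = 1) (h12 : (orderCoeffs a b).e12 = 1)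
    (h32 : (orderCoeffs a b).e32 = 0) (L₁ L₂ Z : Matrix (Fin n) (Fin n) ℝ)
    (hZ : Z = quintic (orderCoeffs a b) L₁ L₂ -
      ((orderCoeffs a b).e31 ^ 2) • ⁅L₁, ⁅L₁, commC L₁ L₂⁆⁆) :
    HasOrder (scheme a b ζ₁ ζ₂ L₁ L₂ Z) (L₁ + L₂) 6 := by
  obtain ⟨e, he⟩ := exists_hasExpansion hp
  -- By uniqueness in the free algebra the recursively computed coefficients are `orderCoeffs a b`;
  -- the same expansion can now be used for matrices.
  obtain rfl := (he.isOrderExpansion hl).orderCoeffs_eq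
  set c := (orderCoeffs a b).e31 with hc
  apply HasJet.hasOrder
  have h₁ := (HasJet.list_prod (fun s => hasJet_stageMatrix L₁ L₂ Z c s) l).congr_series
    (he (Matrix (Fin n) (Fin n) ℝ) L₁ L₂ Z c)
  have h₂ : gradientExponent (orderCoeffs a b) L₁ L₂ Z c (l.map fun s => s.2.2).sum =
      oddSeries (L₁ + L₂) 0 0 := by
    rw [gradientExponent, hl.sum_weights, hζ, h11, h12, h32, hZ, ← hc]
    congr 1 <;> module
  rw [h₂] at h₁
  convert h₁ using 1
  funext h
  rw [scheme_eq_prod]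
  exact hl _ (fun s => stageMatrix L₁ L₂ Z c s h) (by simp [stageMatrix]) (by simp [stageMatrix])

end Order

/-! ### Dissipativity of the stages and parity of brackets -/

section Dissipation

open Matrix

/-- The exponential of a dissipative matrix does not increase the Hamiltonian. -/
theorem hamiltonian_exp_mulVec_le {S : Matrix (Fin n) (Fin n) ℝ}
    (hS : ∀ y, y ⬝ᵥ S *ᵥ y ≤ 0) (x : Fin n → ℝ) :
    hamiltonian (NormedSpace.exp S *ᵥ x) ≤ hamiltonian x := by
  let _ := Matrix.linftyOpNormedRing (n := Fin n) (α := ℝ)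
  let _ := Matrix.linftyOpNormedAlgebra (n := Fin n) (R := ℝ) (α := ℝ)
  set y : ℝ → Fin n → ℝ := fun t => NormedSpace.exp (t • S) *ᵥ x with hy
  have hy' : ∀ t, HasDerivAt y (S *ᵥ y t) t := by
    intro t
    have h₁ := hasDerivAt_exp_smul_const' (𝕂 := ℝ) S t
    have h₂ := (LinearMap.toContinuousLinearMap ((Matrix.mulVecBilin ℝ ℝ).flip x :
      Matrix (Fin n) (Fin n) ℝ →ₗ[ℝ] Fin n → ℝ)).hasFDerivAt.comp_hasDerivAt t h₁
    rw [hy]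
    dsimp only
    rw [mulVec_mulVec]
    exact h₂
  -- The energy decreases along the flow y' = S y, whose time-one map is exp S.
  have hφ : ∀ t, HasDerivAt (fun t => y t ⬝ᵥ y t) (2 * (y t ⬝ᵥ S *ᵥ y t)) t := by
    intro t
    have h₁ := hasDerivAt_pi.1 (hy' t)
    refine (HasDerivAt.fun_sum (u := Finset.univ) fun i _ => (h₁ i).mul (h₁ i)).congr_deriv ?_
    simp only [dotProduct, Finset.mul_sum]
    refine Finset.sum_congr rfl fun i _ => ?_
    ring
  have hanti : Antitone fun t => y t ⬝ᵥ y t :=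
    antitone_of_deriv_nonpos (fun t => (hφ t).differentiableAt) fun t => by
      rw [(hφ t).deriv]; linarith [hS (y t)]
  have h := hanti (zero_le_one (α := ℝ))
  simp only [hy, one_smul, zero_smul, NormedSpace.exp_zero, one_mulVec] at h
  unfold hamiltonian
  linarith

theorem dotProduct_mulVec_eq_zero {Z : Matrix (Fin n) (Fin n) ℝ} (hZ : Zᵀ = -Z)
    (y : Fin n → ℝ) : y ⬝ᵥ Z *ᵥ y = 0 := by
  have h : y ⬝ᵥ Z *ᵥ y = -(y ⬝ᵥ Z *ᵥ y) := by
    conv_lhs => rw [dotProduct_mulVec, ← mulVec_transpose, hZ, neg_mulVec, neg_dotProduct,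
      dotProduct_comm]
  linarith

theorem dissipationPreserving_scheme {m : ℕ} {a b ζ₁ ζ₂ : Fin m → ℝ} (ha : ∀ j, 0 ≤ a j)
    {R J Z : Matrix (Fin n) (Fin n) ℝ} (hR : R.PosSemidef) (hJ : Jᵀ = -J)
    (hC : (commC (-R) J)ᵀ = -commC (-R) J) (hZ : Zᵀ = -Z) :
    DissipationPreserving (scheme a b ζ₁ ζ₂ (-R) J Z) := by
  intro h hh
  have key : ∀ l : List (Matrix (Fin n) (Fin n) ℝ),
      (∀ M ∈ l, ∀ x, hamiltonian (M *ᵥ x) ≤ hamiltonian x) →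
      ∀ x, hamiltonian (l.prod *ᵥ x) ≤ hamiltonian x := by
    intro l hl
    induction l with
    | nil => simp
    | cons M l ih =>
      intro x
      rw [List.prod_cons, ← mulVec_mulVec]
      exact (hl M (by simp) _).trans (ih (fun M hM => hl M (by simp [hM])) x)
  refine key _ fun M hM x => ?_
  obtain ⟨j, rfl⟩ := (List.mem_ofFn' _ _).1 hM
  dsimp only
  rw [← mulVec_mulVec]
  refine (hamiltonian_exp_mulVec_le (fun y => ?_) _).trans
    (hamiltonian_exp_mulVec_le (fun y => ?_) x)
  · have h₁ : 0 ≤ y ⬝ᵥ R *ᵥ y := by simpa using hR.dotProduct_mulVec_nonneg y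
    rw [sub_mulVec, smul_mulVec, smul_mulVec, dotProduct_sub, dotProduct_smul, dotProduct_smul,
      dotProduct_mulVec_eq_zero hZ, neg_mulVec, dotProduct_neg, smul_zero, sub_zero, smul_eq_mul]
    have := mul_nonneg (mul_nonneg (ha j) hh) h₁
    linarith
  · rw [sub_mulVec, smul_mulVec, smul_mulVec, sub_mulVec, smul_mulVec, dotProduct_sub,
      dotProduct_smul, dotProduct_smul, dotProduct_sub, dotProduct_smul,
      dotProduct_mulVec_eq_zero hZ, dotProduct_mulVec_eq_zero hC, dotProduct_mulVec_eq_zero hJ]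
    simp

/-- This and the next three are the parity rules of the Lie algebra automorphism M ↦ -Mᵀ, which
fixes skew matrices and negates symmetric ones. -/
theorem lie_symm_symm {S T : Matrix (Fin n) (Fin n) ℝ} (hS : Sᵀ = S) (hT : Tᵀ = T) :
    ⁅S, T⁆ᵀ = -⁅S, T⁆ := by
  simp [Ring.lie_def, transpose_sub, transpose_mul, hS, hT]

theorem lie_symm_skew {S T : Matrix (Fin n) (Fin n) ℝ} (hS : Sᵀ = S) (hT : Tᵀ = -T) :
    ⁅S, T⁆ᵀ = ⁅S, T⁆ := by
  simp [Ring.lie_def, transpose_sub, transpose_mul, hS, hT]; abel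

theorem lie_skew_symm {S T : Matrix (Fin n) (Fin n) ℝ} (hS : Sᵀ = -S) (hT : Tᵀ = T) :
    ⁅S, T⁆ᵀ = ⁅S, T⁆ := by
  simp [Ring.lie_def, transpose_sub, transpose_mul, hS, hT]; abel

theorem lie_skew_skew {S T : Matrix (Fin n) (Fin n) ℝ} (hS : Sᵀ = -S) (hT : Tᵀ = -T) :
    ⁅S, T⁆ᵀ = -⁅S, T⁆ := by
  simp [Ring.lie_def, transpose_sub, transpose_mul, hS, hT]

end Dissipation

/-! ### The force gradients: skew-symmetry and cancellation of the quintic term -/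

section Main

open Matrix

variable {J R : Matrix (Fin n) (Fin n) ℝ}

theorem transpose_neg_of_posSemidef (hR : R.PosSemidef) : (-R)ᵀ = -R := by
  rw [transpose_neg, ← conjTranspose_eq_transpose_of_trivial, hR.isHermitian.eq]

theorem commC_skew (hJ : Jᵀ = -J) (hR : R.PosSemidef) :
    (commC (-R) J)ᵀ = -commC (-R) J := by
  have hR' := transpose_neg_of_posSemidef hR
  exact lie_symm_symm hR' (lie_symm_skew hR' hJ)

theorem gradientA_skew {m : ℕ} (a b : Fin m → ℝ) (hJ : Jᵀ = -J) (hR : R.PosSemidef) :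
    (gradientA a b (-R) J)ᵀ = -gradientA a b (-R) J := by
  have hR' := transpose_neg_of_posSemidef hR
  have h₁ := lie_symm_symm hR' (lie_symm_skew hR' (commC_skew hJ hR))
  have h₂ := lie_symm_symm hR' (lie_skew_symm hJ (lie_skew_symm hJ (lie_symm_skew hR' hJ)))
  rw [gradientA, transpose_add, transpose_smul, transpose_smul, h₁, commD, h₂]
  module

theorem gradientB_skew {m : ℕ} (a b : Fin m → ℝ) (hJ : Jᵀ = -J) (hR : R.PosSemidef) :
    (gradientB a b (-R) J)ᵀ = -gradientB a b (-R) J := by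
  have hR' := transpose_neg_of_posSemidef hR
  have h₁ := lie_symm_symm hR' (lie_symm_skew hR' (commC_skew hJ hR))
  have h₂ := lie_skew_skew hJ (lie_skew_skew hJ (commC_skew hJ hR))
  rw [gradientB, transpose_add, transpose_smul, transpose_smul, h₁, h₂]
  module

/-- The brackets with e₅₂ and e₅₅ vanish because [L₁,D] = [L₂,C] = 0; e₅₄ and e₅₆ vanish by the
order conditions. -/
theorem gradientA_eq {m : ℕ} {a b : Fin m → ℝ} (hab : SolvesClassA a b)
    {L₁ L₂ : Matrix (Fin n) (Fin n) ℝ} (h : ⁅L₁, commD L₁ L₂⁆ = 0) :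
    gradientA a b L₁ L₂ = quintic (orderCoeffs a b) L₁ L₂ -
      ((orderCoeffs a b).e31 ^ 2) • ⁅L₁, ⁅L₁, commC L₁ L₂⁆⁆ := by
  have h' : ⁅L₂, commC L₁ L₂⁆ = 0 := by rw [commC, lie_swap_commC]; exact h
  rw [gradientA, quintic, e51Tilde, hab.e54, hab.e56, h, h']
  simp only [Ring.lie_def, mul_zero, zero_mul]
  module

/-- Here [L₂,D] = 0 removes the brackets with e₅₃ and e₅₆, and the order conditions those with e₅₂
and e₅₄. -/
theorem gradientB_eq {m : ℕ} {a b : Fin m → ℝ} (hab : SolvesClassB a b)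
    {L₁ L₂ : Matrix (Fin n) (Fin n) ℝ} (h : ⁅L₂, commD L₁ L₂⁆ = 0) :
    gradientB a b L₁ L₂ = quintic (orderCoeffs a b) L₁ L₂ -
      ((orderCoeffs a b).e31 ^ 2) • ⁅L₁, ⁅L₁, commC L₁ L₂⁆⁆ := by
  rw [gradientB, quintic, e51Tilde, hab.e52, hab.e54, h]
  simp only [Ring.lie_def, mul_zero, zero_mul]
  module

end Main

end Matrices

/-! ### A quantitative existence theorem for zeros -/

section NewtonMethod

/-- On the unit ball (for the maximum norm) the function `g`, its derivative and half the Lipschitz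
constant of its derivative have bounds that sum up to at most `N`. -/
def SmoothBound (N : ℝ) (g : (Fin 3 → ℝ) → ℝ) : Prop :=
  ∃ (g' : (Fin 3 → ℝ) → (Fin 3 → ℝ) →L[ℝ] ℝ) (a b c : ℝ), (∀ x, HasFDerivAt g (g' x) x) ∧
    0 ≤ a ∧ 0 ≤ b ∧ 0 ≤ c ∧ a + b + c ≤ N ∧
    (∀ x ∈ Metric.closedBall (0 : Fin 3 → ℝ) 1, |g x| ≤ a) ∧
    (∀ x ∈ Metric.closedBall (0 : Fin 3 → ℝ) 1, ‖g' x‖ ≤ b) ∧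
    ∀ x ∈ Metric.closedBall (0 : Fin 3 → ℝ) 1, ∀ y ∈ Metric.closedBall (0 : Fin 3 → ℝ) 1,
      ‖g' x - g' y‖ ≤ 2 * c * ‖x - y‖

theorem abs_sub_le_of_hasFDerivAt {g : (Fin 3 → ℝ) → ℝ}
    {g' : (Fin 3 → ℝ) → (Fin 3 → ℝ) →L[ℝ] ℝ} {b : ℝ} {s : Set (Fin 3 → ℝ)} (hs : Convex ℝ s)
    (hg : ∀ x, HasFDerivAt g (g' x) x) (hb : ∀ x ∈ s, ‖g' x‖ ≤ b)
    {x y : Fin 3 → ℝ} (hx : x ∈ s) (hy : y ∈ s) : |g x - g y| ≤ b * ‖x - y‖ := by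
  simpa using hs.norm_image_sub_le_of_norm_hasFDerivWithin_le
    (fun z _ => (hg z).hasFDerivWithinAt) hb hy hx

namespace SmoothBound

variable {f g : (Fin 3 → ℝ) → ℝ} {M N : ℝ}

theorem mono (h : SmoothBound M g) (hMN : M ≤ N) : SmoothBound N g := by
  obtain ⟨g', a, b, c, h₁, ha, hb, hc, hN, h₂⟩ := h
  exact ⟨g', a, b, c, h₁, ha, hb, hc, hN.trans hMN, h₂⟩

theorem const (t : ℝ) : SmoothBound |t| fun _ => t :=
  ⟨fun _ => 0, |t|, 0, 0, fun x => hasFDerivAt_const t x, abs_nonneg t, le_rfl, le_rfl, by simp,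
    fun _ _ => le_rfl, fun _ _ => by simp, fun _ _ _ _ => by simp⟩

theorem coord (i : Fin 3) : SmoothBound 2 fun x => x i := by
  refine ⟨fun _ => ContinuousLinearMap.proj i, 1, 1, 0, fun x => hasFDerivAt_apply i x,
    by norm_num, by norm_num, le_rfl, by norm_num, fun x hx => ?_, fun x _ => ?_,
    fun _ _ _ _ => by simp⟩
  · exact (norm_le_pi_norm x i).trans (by simpa using hx)
  · exact ContinuousLinearMap.opNorm_le_bound _ zero_le_one fun y => by
      simpa using norm_le_pi_norm y i

theorem add (hf : SmoothBound M f) (hg : SmoothBound N g) :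
    SmoothBound (M + N) fun x => f x + g x := by
  obtain ⟨f', a, b, c, h₁, ha, hb, hc, hM, h₂, h₃, h₄⟩ := hf
  obtain ⟨g', a', b', c', h₁', ha', hb', hc', hN, h₂', h₃', h₄'⟩ := hg
  refine ⟨fun x => f' x + g' x, a + a', b + b', c + c', fun x => (h₁ x).add (h₁' x), by positivity,
    by positivity, by positivity, by linarith, fun x hx => ?_, fun x hx => ?_,
    fun x hx y hy => ?_⟩
  · exact (abs_add_le _ _).trans (add_le_add (h₂ x hx) (h₂' x hx))
  · exact (norm_add_le _ _).trans (add_le_add (h₃ x hx) (h₃' x hx))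
  · rw [add_sub_add_comm, mul_add, add_mul]
    exact (norm_add_le _ _).trans (add_le_add (h₄ x hx y hy) (h₄' x hx y hy))

/-- Halving the Lipschitz constant makes the bound submultiplicative: the mixed term 2 f' g' then
contributes just b b', which occurs in (a + b + c)(a' + b' + c'). -/
theorem mul (hf : SmoothBound M f) (hg : SmoothBound N g) :
    SmoothBound (M * N) fun x => f x * g x := by
  obtain ⟨f', a, b, c, h₁, ha, hb, hc, hM, h₂, h₃, h₄⟩ := hf
  obtain ⟨g', a', b', c', h₁', ha', hb', hc', hN, h₂', h₃', h₄'⟩ := hg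
  refine ⟨fun x => f x • g' x + g x • f' x, a * a', a * b' + a' * b, a * c' + b * b' + a' * c,
    fun x => (h₁ x).mul (h₁' x), by positivity, by positivity, by positivity, ?_,
    fun x hx => ?_, fun x hx => ?_, fun x hx y hy => ?_⟩
  · calc a * a' + (a * b' + a' * b) + (a * c' + b * b' + a' * c)
        ≤ (a + b + c) * (a' + b' + c') := by
          nlinarith [mul_nonneg hb hc', mul_nonneg hc hb', mul_nonneg hc hc']
      _ ≤ M * N := mul_le_mul hM hN (by positivity) (by linarith)
  · rw [abs_mul]
    exact mul_le_mul (h₂ x hx) (h₂' x hx) (abs_nonneg _) ha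
  · refine (norm_add_le _ _).trans (add_le_add ?_ ?_)
    · rw [norm_smul]
      exact mul_le_mul (h₂ x hx) (h₃' x hx) (norm_nonneg _) ha
    · rw [norm_smul]
      exact mul_le_mul (h₂' x hx) (h₃ x hx) (norm_nonneg _) ha'
  · have hfl := abs_sub_le_of_hasFDerivAt (convex_closedBall _ _) h₁ h₃ hx hy
    have hgl := abs_sub_le_of_hasFDerivAt (convex_closedBall _ _) h₁' h₃' hx hy
    have h₅ : f x • g' x + g x • f' x - (f y • g' y + g y • f' y) =
        (f x • (g' x - g' y) + (f x - f y) • g' y) +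
          (g x • (f' x - f' y) + (g x - g y) • f' y) := by module
    rw [h₅]
    have e₁ : ‖f x • (g' x - g' y)‖ ≤ a * (2 * c' * ‖x - y‖) := by
      rw [norm_smul]
      exact mul_le_mul (h₂ x hx) (h₄' x hx y hy) (norm_nonneg _) ha
    have e₂ : ‖(f x - f y) • g' y‖ ≤ b * ‖x - y‖ * b' := by
      rw [norm_smul]
      exact mul_le_mul hfl (h₃' y hy) (norm_nonneg _) (by positivity)
    have e₃ : ‖g x • (f' x - f' y)‖ ≤ a' * (2 * c * ‖x - y‖) := by
      rw [norm_smul]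
      exact mul_le_mul (h₂' x hx) (h₄ x hx y hy) (norm_nonneg _) ha'
    have e₄ : ‖(g x - g y) • f' y‖ ≤ b' * ‖x - y‖ * b := by
      rw [norm_smul]
      exact mul_le_mul hgl (h₃ y hy) (norm_nonneg _) (by positivity)
    refine (norm_add_le_of_le (norm_add_le_of_le e₁ e₂) (norm_add_le_of_le e₃ e₄)).trans
      (le_of_eq ?_)
    ring

theorem sub (hf : SmoothBound M f) (hg : SmoothBound N g) :
    SmoothBound (M + N) fun x => f x - g x := by
  have h := hf.add ((const (-1)).mul hg)
  simpa [sub_eq_add_neg] using h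

theorem pow (hf : SmoothBound M f) (k : ℕ) : SmoothBound (M ^ k) fun x => f x ^ k := by
  induction k with
  | zero => simpa using const 1
  | succ k ih => simpa only [pow_succ] using ih.mul hf

theorem div_const (hf : SmoothBound M f) (t : ℝ) : SmoothBound (M * |t⁻¹|) fun x => f x / t := by
  simpa only [div_eq_mul_inv] using hf.mul (const t⁻¹)

theorem abs_sub_le (hg : SmoothBound N g) {x y : Fin 3 → ℝ}
    (hx : x ∈ Metric.closedBall (0 : Fin 3 → ℝ) 1) (hy : y ∈ Metric.closedBall (0 : Fin 3 → ℝ) 1) :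
    |g x - g y| ≤ N * ‖x - y‖ := by
  obtain ⟨g', a, b, c, h₁, ha, hb, hc, hN, h₂, h₃, h₄⟩ := hg
  exact (abs_sub_le_of_hasFDerivAt (convex_closedBall _ _) h₁ h₃ hx hy).trans
    (mul_le_mul_of_nonneg_right (by linarith) (norm_nonneg _))

end SmoothBound

/-- A quantitative zero theorem: if difference quotients of step size `h` of `F` at `x₀` are close
to those of the identity, and `F x₀` is small, then `F` has a zero close to `x₀`. -/
theorem exists_zero_near {N h r : ℝ} {x₀ : Fin 3 → ℝ} {F : Fin 3 → (Fin 3 → ℝ) → ℝ}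
    (hF : ∀ k, SmoothBound N (F k)) (hh : 0 < h) (hr : 0 ≤ r) (hx₀ : ‖x₀‖ + h + r ≤ 1)
    (hN : 2 * N * (h + r) ≤ 1 / 12)
    (hquot : ∀ k j, |F k (x₀ + Pi.single j h) - F k x₀ - (if k = j then h else 0)| ≤ h / 12)
    (h₀ : ∀ k, |F k x₀| ≤ r / 2) :
    ∃ x, ‖x - x₀‖ ≤ r ∧ ∀ k, F k x = 0 := by
  choose F' a b c hd ha hb hc hsum hbound hbound' hlip using hF
  have hball : ∀ x, ‖x - x₀‖ ≤ h + r → x ∈ Metric.closedBall (0 : Fin 3 → ℝ) 1 := by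
    intro x hx
    have := norm_add_le (x - x₀) x₀
    rw [sub_add_cancel] at this
    rw [mem_closedBall_zero_iff]
    linarith
  have hN0 : 0 ≤ N := by linarith [hsum 0, ha 0, hb 0, hc 0]
  have hder : ∀ k j x, ‖x - x₀‖ ≤ r →
      |F' k x (Pi.single j 1) - (if k = j then 1 else 0)| ≤ 1 / 6 := by
    intro k j x hx
    -- The mean value inequality compares the difference quotient at x₀ with the derivative at x;
    -- this error and that of the quotient are at most 1/12 each.
    have h₁ := abs_sub_le_of_hasFDerivAt (g := fun z => F k z - F' k x z)
      (g' := fun z => F' k z - F' k x) (b := 2 * N * (h + r)) (s := Metric.closedBall x₀ h)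
      (convex_closedBall _ _) (fun z => (hd k z).sub (F' k x).hasFDerivAt) (fun z hz => ?_)
      (x := x₀ + Pi.single j h) (y := x₀)
      (by simp [Pi.norm_single, abs_of_pos hh]) (by simp [hh.le])
    · have hP : (Pi.single j h : Fin 3 → ℝ) = h • Pi.single j 1 := by
        rw [← Pi.single_smul, smul_eq_mul, mul_one]
      have h₂ := hquot k j
      have h₃ : ‖(Pi.single j h : Fin 3 → ℝ)‖ = h := by
        rw [Pi.norm_single, Real.norm_of_nonneg hh.le]
      rw [add_sub_cancel_left, h₃, map_add] at h₁
      have h₄ : F' k x (Pi.single j h) = h * F' k x (Pi.single j 1) := by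
        rw [hP, map_smul, smul_eq_mul]
      rw [h₄] at h₁
      have h₅ : 2 * N * (h + r) * h ≤ 1 / 12 * h := mul_le_mul_of_nonneg_right hN hh.le
      have h₆ : h * |F' k x (Pi.single j 1) - (if k = j then 1 else 0)| ≤ h * (1 / 6) := by
        rw [← abs_of_pos hh, ← abs_mul, abs_of_pos hh, mul_sub, mul_ite, mul_one, mul_zero, abs_le]
        rw [abs_le] at h₁ h₂
        constructor <;> linarith [h₁.1, h₁.2, h₂.1, h₂.2]
      exact le_of_mul_le_mul_left h₆ hh
    · rw [mem_closedBall_iff_norm] at hz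
      have h₂ : ‖z - x‖ ≤ h + r := by
        have := norm_sub_le (z - x₀) (x - x₀)
        rw [sub_sub_sub_cancel_right] at this
        linarith
      refine (hlip k z (hball z (by linarith)) x (hball x (by linarith))).trans ?_
      have : 2 * c k ≤ 2 * N := by linarith [hsum k, ha k, hb k]
      exact mul_le_mul this h₂ (norm_nonneg _) (by linarith)
  -- Zeros of F are fixed points of G. Each row of the derivative of G has three entries of size at
  -- most 1/6, so G contracts the maximum norm by 1/2.
  set G : (Fin 3 → ℝ) → Fin 3 → ℝ := fun x k => x k - F k x with hG
  have hGlip : ∀ x ∈ Metric.closedBall x₀ r, ∀ y ∈ Metric.closedBall x₀ r,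
      ‖G x - G y‖ ≤ 1 / 2 * ‖x - y‖ := by
    intro x hx y hy
    refine (pi_norm_le_iff_of_nonneg (by positivity)).2 fun k => ?_
    refine abs_sub_le_of_hasFDerivAt (g := fun z => z k - F k z)
      (g' := fun z => ContinuousLinearMap.proj k - F' k z) (convex_closedBall x₀ r)
      (fun z => (hasFDerivAt_apply k z).sub (hd k z)) (fun z hz => ?_) hx hy
    rw [mem_closedBall_iff_norm] at hz
    refine ContinuousLinearMap.opNorm_le_bound _ (by norm_num) fun v => ?_
    have hv : (ContinuousLinearMap.proj k - F' k z : (Fin 3 → ℝ) →L[ℝ] ℝ) v =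
        ∑ j, v j * -(F' k z (Pi.single j 1) - (if k = j then 1 else 0)) := by
      have h₁ : F' k z v = ∑ j, v j * F' k z (Pi.single j 1) := by
        conv_lhs => rw [pi_eq_sum_univ' v, map_sum]
        refine Finset.sum_congr rfl fun j _ => ?_
        rw [map_smul, smul_eq_mul]
      simp only [neg_sub, mul_sub, Finset.sum_sub_distrib, mul_ite, mul_one, mul_zero,
        Finset.sum_ite_eq, Finset.mem_univ, if_true, ← h₁]
      rfl
    rw [hv]
    refine (norm_sum_le _ _).trans ?_
    have h₂ : ∀ j ∈ Finset.univ,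
        ‖v j * -(F' k z (Pi.single j 1) - (if k = j then 1 else 0))‖ ≤ ‖v‖ * (1 / 6) := by
      intro j _
      rw [norm_mul, norm_neg]
      exact mul_le_mul (norm_le_pi_norm v j) (hder k j z hz) (norm_nonneg _) (norm_nonneg _)
    refine (Finset.sum_le_sum h₂).trans (le_of_eq ?_)
    simp
    ring
  have hx₀mem : x₀ ∈ Metric.closedBall x₀ r := Metric.mem_closedBall_self hr
  have hmaps : Set.MapsTo G (Metric.closedBall x₀ r) (Metric.closedBall x₀ r) := by
    intro x hx
    have h₁ := hGlip x hx x₀ hx₀mem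
    -- Half of the radius is used by the displacement of the centre and half by the contraction.
    have h₂ : ‖G x₀ - x₀‖ ≤ r / 2 := by
      refine (pi_norm_le_iff_of_nonneg (by positivity)).2 fun k => ?_
      simpa [hG] using h₀ k
    rw [mem_closedBall_iff_norm] at hx ⊢
    have h₃ := norm_add_le (G x - G x₀) (G x₀ - x₀)
    rw [sub_add_sub_cancel] at h₃
    linarith
  have hcontr : ContractingWith (1 / 2) (hmaps.restrict G _ _) := by
    refine ⟨by norm_num, LipschitzWith.of_dist_le_mul fun x y => ?_⟩
    rw [Subtype.dist_eq, Subtype.dist_eq, dist_eq_norm, dist_eq_norm]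
    simpa using hGlip x x.2 y y.2
  obtain ⟨x, hx, hfix, -⟩ := hcontr.exists_fixedPoint' Metric.isClosed_closedBall.isComplete hmaps
    hx₀mem (edist_ne_top _ _)
  refine ⟨x, by simpa [dist_eq_norm] using hx, fun k => ?_⟩
  have := congrFun hfix k
  simp only [hG] at this
  linarith

end NewtonMethod

/-! ### The nine-stage family and its exact solutions -/

section NineStages

/-- The order coefficients of the symmetric nine-stage scheme with the inner step sizes
`u, (v - u) / 2, (1 - v) / 2` for the first and `w / 2, (1 - w) / 2` for the second subproblem. -/
noncomputable def nineStage (u v w : ℝ) : OrderCoeffs where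
  e11 := 1
  e12 := 1
  e31 := (3 * u ^ 2 * w - 3 * v ^ 2 * w + 3 * v ^ 2 - 1) / 24
  e32 := (3 * u * w ^ 2 - 3 * v * w ^ 2 + 3 * v - 2) / 24
  e51 := (15 * u ^ 4 * w - 15 * v ^ 4 * w + 15 * v ^ 4 - 30 * u ^ 2 * w + 30 * v ^ 2 * w -
    30 * v ^ 2 + 7) / 5760
  e52 := (-15 * u ^ 3 * w ^ 2 + 30 * u ^ 2 * v * w ^ 2 - 15 * v ^ 3 * w ^ 2 -
    30 * u ^ 2 * v * w + 30 * v ^ 3 * w + 10 * u ^ 2 * w - 5 * u * w ^ 2 - 15 * v ^ 3 -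
    10 * v ^ 2 * w + 5 * v * w ^ 2 + 10 * v ^ 2 - 5 * v + 2) / 960
  e53 := (-15 * u ^ 2 * w ^ 3 + 45 * u * v * w ^ 3 - 30 * v ^ 2 * w ^ 3 - 45 * u * v * w ^ 2 +
    45 * v ^ 2 * w ^ 2 + 15 * u * w ^ 2 - 15 * v * w ^ 2 - 15 * v ^ 2 + 15 * v - 4) / 1440
  e54 := (30 * u ^ 3 * w ^ 2 - 45 * u ^ 2 * v * w ^ 2 + 15 * v ^ 3 * w ^ 2 + 45 * u ^ 2 * v * w -
    45 * v ^ 3 * w - 30 * u ^ 2 * w + 30 * v ^ 3 + 30 * v ^ 2 * w - 30 * v ^ 2 + 4) / 1440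
  e55 := (15 * u ^ 2 * w ^ 3 - 30 * u * v * w ^ 3 + 15 * v ^ 2 * w ^ 3 + 30 * u * v * w ^ 2 -
    30 * v ^ 2 * w ^ 2 - 5 * u ^ 2 * w - 20 * u * w ^ 2 + 5 * v ^ 2 * w + 20 * v * w ^ 2 +
    10 * v ^ 2 - 20 * v + 8) / 960
  e56 := (15 * u * w ^ 4 - 15 * v * w ^ 4 - 30 * u * w ^ 2 + 30 * v * w ^ 2 - 15 * v + 8) / 5760

/-- The parameters are partial sums from the centre outwards: u is the central step, v the sum of
the inner three, w that of the inner two of the other subproblem. Thus e₁₁ = e₁₂ = 1 is built in,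
and three unknowns face three equations. -/
theorem steps_eq_nineStage (u v w : ℝ) :
    (((OrderCoeffs.stepY (w / 2) ⟨u, 0, 0, 0, 0, 0, 0, 0, 0, 0⟩).stepX ((v - u) / 2)).stepY
      ((1 - w) / 2)).stepX ((1 - v) / 2) = nineStage u v w := by
  ext <;> simp only [OrderCoeffs.stepX, OrderCoeffs.stepY, OrderCoeffs.swap, nineStage] <;> ring

theorem steps_eq_swap_nineStage (u v w : ℝ) :
    (((OrderCoeffs.stepX (w / 2) ⟨0, u, 0, 0, 0, 0, 0, 0, 0, 0⟩).stepY ((v - u) / 2)).stepX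
      ((1 - w) / 2)).stepY ((1 - v) / 2) = (nineStage u v w).swap := by
  have h₀ : (⟨0, u, 0, 0, 0, 0, 0, 0, 0, 0⟩ : OrderCoeffs) =
      OrderCoeffs.swap ⟨u, 0, 0, 0, 0, 0, 0, 0, 0, 0⟩ := by simp [OrderCoeffs.swap]
  rw [← steps_eq_nineStage]
  simp only [OrderCoeffs.stepY, h₀]

/-- The stages of the nine-stage schemes; `i` is `true` for class a and `false` for class b. -/
noncomputable def nineStageList (i : Bool) (u v w : ℝ) : List Stage :=
  [(i, (1 - v) / 2, 0), (!i, (1 - w) / 2, 0), (i, (v - u) / 2, 0), (!i, w / 2, 0), (i, u, 0),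
    (!i, w / 2, 0), (i, (v - u) / 2, 0), (!i, (1 - w) / 2, 0), (i, (1 - v) / 2, 0)]

theorem hasExpansion_nineStageList_true (u v w : ℝ) :
    HasExpansion (nineStageList true u v w) (nineStage u v w) := by
  have h := ((((hasExpansion_singleton (true, u, 0)).cons_concat (false, w / 2, 0)).cons_concat
    (true, (v - u) / 2, 0)).cons_concat (false, (1 - w) / 2, 0)).cons_concat (true, (1 - v) / 2, 0)
  rw [← steps_eq_nineStage]
  exact h

theorem hasExpansion_nineStageList_false (u v w : ℝ) :
    HasExpansion (nineStageList false u v w) (nineStage u v w).swap := by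
  have h := ((((hasExpansion_singleton (false, u, 0)).cons_concat (true, w / 2, 0)).cons_concat
    (false, (v - u) / 2, 0)).cons_concat (true, (1 - w) / 2, 0)).cons_concat (false, (1 - v) / 2, 0)
  rw [← steps_eq_swap_nineStage]
  exact h

theorem orderCoeffs_nineStage_classA (u v w : ℝ) :
    orderCoeffs ![(1 - v) / 2, (v - u) / 2, u, (v - u) / 2, (1 - v) / 2]
      ![(1 - w) / 2, w / 2, w / 2, (1 - w) / 2, 0] = nineStage u v w := by
  refine ((hasExpansion_nineStageList_true u v w).isOrderExpansion
    (ζ₁ := fun _ => 0) (ζ₂ := fun _ => 0) fun M _ F _ h₂ => ?_).orderCoeffs_eq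
  simp [nineStageList, List.ofFn_succ, mul_assoc, h₂]

theorem orderCoeffs_nineStage_classB (u v w : ℝ) :
    orderCoeffs ![0, (1 - w) / 2, w / 2, w / 2, (1 - w) / 2]
      ![(1 - v) / 2, (v - u) / 2, u, (v - u) / 2, (1 - v) / 2] = (nineStage u v w).swap := by
  refine ((hasExpansion_nineStageList_false u v w).isOrderExpansion
    (ζ₁ := fun _ => 0) (ζ₂ := fun _ => 0) fun M _ F h₁ _ => ?_).orderCoeffs_eq
  simp [nineStageList, List.ofFn_succ, mul_assoc, h₁]

theorem isClassA_nineStage (u v w : ℝ) :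
    IsClassA ![(1 - v) / 2, (v - u) / 2, u, (v - u) / 2, (1 - v) / 2]
      ![(1 - w) / 2, w / 2, w / 2, (1 - w) / 2, 0] := by
  refine ⟨fun i j h => ?_, fun i h => ?_, fun i j h => ?_⟩
  · fin_cases i <;> fin_cases j <;> simp at h ⊢
  · fin_cases i <;> simp at h ⊢
  · fin_cases i <;> fin_cases j <;> simp at h ⊢

theorem isClassB_nineStage (u v w : ℝ) :
    IsClassB ![0, (1 - w) / 2, w / 2, w / 2, (1 - w) / 2]
      ![(1 - v) / 2, (v - u) / 2, u, (v - u) / 2, (1 - v) / 2] := by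
  refine ⟨fun i h => ?_, fun i j h => ?_, fun i j h => ?_⟩
  · fin_cases i <;> simp at h ⊢
  · fin_cases i <;> fin_cases j <;> simp at h ⊢
  · fin_cases i <;> fin_cases j <;> simp at h ⊢

section Bounds

/-- Every order coefficient of order three or five is bounded, with its derivatives. -/
theorem smoothBound_nineStage (π : OrderCoeffs → ℝ)
    (hπ : π ∈ ({OrderCoeffs.e31, OrderCoeffs.e32, OrderCoeffs.e51, OrderCoeffs.e52,
      OrderCoeffs.e53, OrderCoeffs.e54, OrderCoeffs.e55, OrderCoeffs.e56} :
        Set (OrderCoeffs → ℝ))) :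
    SmoothBound 4 fun x => π (nineStage (x 0) (x 1) (x 2)) := by
  simp only [Set.mem_insert_iff, Set.mem_singleton_iff] at hπ
  rcases hπ with rfl | rfl | rfl | rfl | rfl | rfl | rfl | rfl <;> unfold nineStage <;>
    refine SmoothBound.mono (by
      repeat apply_rules (transparency := reducible) [SmoothBound.div_const, SmoothBound.sub,
        SmoothBound.add, SmoothBound.mul, SmoothBound.pow, SmoothBound.coord,
        SmoothBound.const]) ?_ <;>
    norm_num

theorem abs_nineStage_sub_le (π : OrderCoeffs → ℝ)
    (hπ : π ∈ ({OrderCoeffs.e31, OrderCoeffs.e32, OrderCoeffs.e51, OrderCoeffs.e52,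
      OrderCoeffs.e53, OrderCoeffs.e54, OrderCoeffs.e55, OrderCoeffs.e56} :
        Set (OrderCoeffs → ℝ))) {x x₀ : Fin 3 → ℝ} {r : ℝ} (hx : ‖x - x₀‖ ≤ r)
    (hx₀ : ‖x₀‖ + r ≤ 1) :
    |π (nineStage (x 0) (x 1) (x 2)) - π (nineStage (x₀ 0) (x₀ 1) (x₀ 2))| ≤ 4 * r := by
  have h := norm_add_le (x - x₀) x₀
  rw [sub_add_cancel] at h
  have h₀ := norm_nonneg (x - x₀)
  refine ((smoothBound_nineStage π hπ).abs_sub_le (x := x) (y := x₀) ?_ ?_).trans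
    (mul_le_mul_of_nonneg_left hx (by norm_num)) <;>
    rw [mem_closedBall_zero_iff] <;> linarith

/-- An approximate solution of the class-a order conditions. -/
noncomputable def approxA : Fin 3 → ℝ :=
  ![0.189266331739231131644836, 0.851669522783095378949598, 0.528479333494409443879861]

/-- An approximate solution of the class-b order conditions. -/
noncomputable def approxB : Fin 3 → ℝ :=
  ![0.276660264277521323604437, 0.809786323716570497579884, 0.556652843231570344898101]

/-- The preconditioned class-a order conditions. -/
noncomputable def residualA (k : Fin 3) (x : Fin 3 → ℝ) : ℝ :=
  -- The integers form an approximate inverse of the Jacobian of (e₃₂, e₅₄, e₅₆) at `approxA`, which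
  -- makes the derivative of the residual nearly the identity.
  ![108, 38, 71] k * (nineStage (x 0) (x 1) (x 2)).e32 +
    ![-17271, -2594, -9559] k * (nineStage (x 0) (x 1) (x 2)).e54 +
    ![16447, 3209, 9864] k * (nineStage (x 0) (x 1) (x 2)).e56

/-- The preconditioned class-b order conditions. -/
noncomputable def residualB (k : Fin 3) (x : Fin 3 → ℝ) : ℝ :=
  ![-43, 12, -21] k * (nineStage (x 0) (x 1) (x 2)).e31 +
    ![7502, 2013, 6484] k * (nineStage (x 0) (x 1) (x 2)).e53 +
    ![-3872, -658, -2874] k * (nineStage (x 0) (x 1) (x 2)).e55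

theorem norm_approxA_le : ‖approxA‖ ≤ 0.9 := by
  refine (pi_norm_le_iff_of_nonneg (by norm_num)).2 fun k => ?_
  fin_cases k <;> simp [approxA, abs_le] <;> norm_num

theorem norm_approxB_le : ‖approxB‖ ≤ 0.9 := by
  refine (pi_norm_le_iff_of_nonneg (by norm_num)).2 fun k => ?_
  fin_cases k <;> simp [approxB, abs_le] <;> norm_num

theorem smoothBound_residualA (k : Fin 3) : SmoothBound 200000 (residualA k) := by
  have h₁ := smoothBound_nineStage OrderCoeffs.e32 (by simp)
  have h₂ := smoothBound_nineStage OrderCoeffs.e54 (by simp)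
  have h₃ := smoothBound_nineStage OrderCoeffs.e56 (by simp)
  refine ((((SmoothBound.const _).mul h₁).add ((SmoothBound.const _).mul h₂)).add
    ((SmoothBound.const _).mul h₃)).mono ?_
  fin_cases k <;> simp <;> norm_num

theorem exists_nineStage_classA : ∃ x : Fin 3 → ℝ, ‖x - approxA‖ ≤ 1e-20 ∧
    (nineStage (x 0) (x 1) (x 2)).e32 = 0 ∧ (nineStage (x 0) (x 1) (x 2)).e54 = 0 ∧
    (nineStage (x 0) (x 1) (x 2)).e56 = 0 := by
  -- With N = 200000 the term 2N(h + r) is about 0.004, well below 1/12. The remaining conditions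
  -- are inequalities between rational numbers.
  obtain ⟨x, hx, h⟩ := exists_zero_near (h := 1e-8) (r := 1e-20) (x₀ := approxA)
    smoothBound_residualA (by norm_num) (by norm_num) (by linarith [norm_approxA_le])
    (by norm_num) (fun k j => by
      fin_cases k <;> fin_cases j <;>
        simp [residualA, nineStage, approxA, abs_le] <;> norm_num)
    (fun k => by
      fin_cases k <;> simp [residualA, nineStage, approxA, abs_le] <;> norm_num)
  have h₀ := h 0
  have h₁ := h 1
  have h₂ := h 2
  simp only [residualA, Matrix.cons_val_zero, Matrix.cons_val_one, Matrix.cons_val] at h₀ h₁ h₂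
  -- The preconditioner is invertible, so the conditions themselves vanish.
  exact ⟨x, hx, by linarith, by linarith, by linarith⟩

theorem smoothBound_residualB (k : Fin 3) : SmoothBound 200000 (residualB k) := by
  have h₁ := smoothBound_nineStage OrderCoeffs.e31 (by simp)
  have h₂ := smoothBound_nineStage OrderCoeffs.e53 (by simp)
  have h₃ := smoothBound_nineStage OrderCoeffs.e55 (by simp)
  refine ((((SmoothBound.const _).mul h₁).add ((SmoothBound.const _).mul h₂)).add
    ((SmoothBound.const _).mul h₃)).mono ?_
  fin_cases k <;> simp <;> norm_num

/-- `OrderCoeffs.swap` puts -e₃₁, -e₅₅, -e₅₃ in the places of e₃₂, e₅₂, e₅₄, so these are the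
class-b conditions before exchanging the subproblems. -/
theorem exists_nineStage_classB : ∃ x : Fin 3 → ℝ, ‖x - approxB‖ ≤ 1e-20 ∧
    (nineStage (x 0) (x 1) (x 2)).e31 = 0 ∧ (nineStage (x 0) (x 1) (x 2)).e53 = 0 ∧
    (nineStage (x 0) (x 1) (x 2)).e55 = 0 := by
  obtain ⟨x, hx, h⟩ := exists_zero_near (h := 1e-8) (r := 1e-20) (x₀ := approxB)
    smoothBound_residualB (by norm_num) (by norm_num) (by linarith [norm_approxB_le])
    (by norm_num) (fun k j => by
      fin_cases k <;> fin_cases j <;>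
        simp [residualB, nineStage, approxB, abs_le] <;> norm_num)
    (fun k => by
      fin_cases k <;> simp [residualB, nineStage, approxB, abs_le] <;> norm_num)
  have h₀ := h 0
  have h₁ := h 1
  have h₂ := h 2
  simp only [residualB, Matrix.cons_val_zero, Matrix.cons_val_one, Matrix.cons_val] at h₀ h₁ h₂
  exact ⟨x, hx, by linarith, by linarith, by linarith⟩

end Bounds

end NineStages

/-! ### Verification of the tabulated values -/

section Tables

/-- Serves `e51Tilde`: s contributes δ, and t² - t₀² = (t - t₀)(t + t₀) contributes 3δ. -/
theorem abs_sub_sq_le {s t s₀ t₀ τ δ ε : ℝ} (hs : |s - s₀| ≤ δ) (ht : |t - t₀| ≤ δ)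
    (hδ : δ ≤ 1) (ht₀ : |t₀| ≤ 1) (h : |s₀ - t₀ ^ 2 - τ| ≤ ε) :
    |s - t ^ 2 - τ| ≤ 4 * δ + ε := by
  have h₁ : |t + t₀| ≤ 3 := by
    rw [abs_le] at *
    constructor <;> linarith [ht.1, ht.2, ht₀.1, ht₀.2]
  have h₂ : |(t - t₀) * (t + t₀)| ≤ δ * 3 := by
    rw [abs_mul]
    exact mul_le_mul ht h₁ (abs_nonneg _) ((abs_nonneg _).trans ht)
  rw [abs_le] at *
  constructor <;> nlinarith [hs.1, hs.2, h₂.1, h₂.2, h.1, h.2]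

theorem abs_sub_le_of_approx {s s₀ τ δ ε : ℝ} (hs : |s - s₀| ≤ δ) (h : |s₀ - τ| ≤ ε) :
    |s - τ| ≤ δ + ε := (abs_sub_le s s₀ τ).trans (add_le_add hs h)

theorem exists_tabulated_classA : ∃ a b : Fin 5 → ℝ, SolvesClassA a b ∧
      |a 0 - 0.0741652386084523| ≤ 5e-16 ∧
      |a 1 - 0.3312015955219320| ≤ 5e-16 ∧
      |a 2 - 0.1892663317392310| ≤ 5e-16 ∧
      |b 0 - 0.2357603332527950| ≤ 5e-16 ∧
      |b 1 - 0.2642396667472050| ≤ 5e-16 ∧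
      |(orderCoeffs a b).e31 - 3.4513723374828328e-3| ≤ 1e-16 ∧
      |e51Tilde a b - (-2.8754632332335723e-5)| ≤ 1e-16 ∧
      |(orderCoeffs a b).e53 - (-7.1694217000153600e-6)| ≤ 1e-16 ∧
      |(orderCoeffs a b).e52 - (-4.2236874448321610e-5)| ≤ 1e-16 ∧
      |(orderCoeffs a b).e55 - (-1.3885239090889685e-5)| ≤ 1e-16 := by
  obtain ⟨x, hx, h32, h54, h56⟩ := exists_nineStage_classA
  have hx₀ : ‖approxA‖ + 1e-20 ≤ 1 := by linarith [norm_approxA_le]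
  have hu := (norm_le_pi_norm _ 0).trans hx
  have hv := (norm_le_pi_norm _ 1).trans hx
  have hw := (norm_le_pi_norm _ 2).trans hx
  simp only [Pi.sub_apply, Real.norm_eq_abs, approxA, Matrix.cons_val_zero, Matrix.cons_val_one,
    Matrix.cons_val, abs_le] at hu hv hw
  have b31 := abs_nineStage_sub_le OrderCoeffs.e31 (by simp) hx hx₀
  have b51 := abs_nineStage_sub_le OrderCoeffs.e51 (by simp) hx hx₀
  have b53 := abs_nineStage_sub_le OrderCoeffs.e53 (by simp) hx hx₀
  have b52 := abs_nineStage_sub_le OrderCoeffs.e52 (by simp) hx hx₀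
  have b55 := abs_nineStage_sub_le OrderCoeffs.e55 (by simp) hx hx₀
  refine ⟨![(1 - x 1) / 2, (x 1 - x 0) / 2, x 0, (x 1 - x 0) / 2, (1 - x 1) / 2],
    ![(1 - x 2) / 2, x 2 / 2, x 2 / 2, (1 - x 2) / 2, 0],
    ⟨isClassA_nineStage _ _ _, ?_, ?_, ?_, ?_, ?_, ?_, ?_⟩, ?_, ?_, ?_, ?_, ?_, ?_⟩
  · intro j; fin_cases j <;> simp <;> linarith
  · intro j; fin_cases j <;> simp <;> linarith
  · rw [orderCoeffs_nineStage_classA]; rfl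
  · rw [orderCoeffs_nineStage_classA]; rfl
  · rw [orderCoeffs_nineStage_classA]; exact h32
  · rw [orderCoeffs_nineStage_classA]; exact h54
  · rw [orderCoeffs_nineStage_classA]; exact h56
  · simp only [Matrix.cons_val_zero, abs_le]; constructor <;> linarith
  · simp only [Matrix.cons_val_one, Matrix.cons_val_zero, abs_le]; constructor <;> linarith
  · simp only [Matrix.cons_val, abs_le]; constructor <;> linarith
  · simp only [Matrix.cons_val_zero, abs_le]; constructor <;> linarith
  · simp only [Matrix.cons_val_one, Matrix.cons_val_zero, abs_le]; constructor <;> linarith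
  · rw [e51Tilde, orderCoeffs_nineStage_classA]
    -- At most 9·10⁻¹⁷ is granted to the rounding of the table at `approxA`; passing to the exact
    -- zero costs at most 1.6·10⁻¹⁹ more.
    refine ⟨(abs_sub_le_of_approx (ε := 9e-17) b31 ?_).trans (by norm_num),
      (abs_sub_sq_le (ε := 9e-17) b51 b31 (by norm_num) ?_ ?_).trans (by norm_num),
      (abs_sub_le_of_approx (ε := 9e-17) b53 ?_).trans (by norm_num),
      (abs_sub_le_of_approx (ε := 9e-17) b52 ?_).trans (by norm_num),
      (abs_sub_le_of_approx (ε := 9e-17) b55 ?_).trans (by norm_num)⟩ <;>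
    simp [nineStage, approxA, abs_le] <;> norm_num

theorem exists_tabulated_classB : ∃ a b : Fin 5 → ℝ, SolvesClassB a b ∧
      |b 0 - 0.0951068381417148| ≤ 5e-16 ∧
      |b 1 - 0.2665630297195250| ≤ 5e-16 ∧
      |b 2 - 0.2766602642775210| ≤ 5e-16 ∧
      |a 1 - 0.2216735783842150| ≤ 5e-16 ∧
      |a 2 - 0.2783264216157850| ≤ 5e-16 ∧
      |(orderCoeffs a b).e31 - 2.7595070959696467e-3| ≤ 1e-16 ∧
      |e51Tilde a b - (-1.4777636968353257e-5)| ≤ 1e-16 ∧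
      |(orderCoeffs a b).e55 - 1.3097476006184691e-5| ≤ 1e-16 ∧
      |(orderCoeffs a b).e53 - 1.2345801613546542e-5| ≤ 1e-16 ∧
      |(orderCoeffs a b).e56 - 1.5869088947135458e-5| ≤ 1e-16 := by
  obtain ⟨x, hx, h31, h53, h55⟩ := exists_nineStage_classB
  have hx₀ : ‖approxB‖ + 1e-20 ≤ 1 := by linarith [norm_approxB_le]
  have hu := (norm_le_pi_norm _ 0).trans hx
  have hv := (norm_le_pi_norm _ 1).trans hx
  have hw := (norm_le_pi_norm _ 2).trans hx
  simp only [Pi.sub_apply, Real.norm_eq_abs, approxB, Matrix.cons_val_zero, Matrix.cons_val_one,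
    Matrix.cons_val, abs_le] at hu hv hw
  have neg : ∀ {s t : ℝ}, |s - t| ≤ 4 * 1e-20 → |-s - -t| ≤ 4 * 1e-20 := by
    intro s t h; rwa [← neg_add', abs_neg, ← sub_eq_add_neg]
  -- After the exchange of subproblems, e₃₁, e₅₁, e₅₅, e₅₃, e₅₆ of the scheme are -e₃₂, -e₅₆, -e₅₂,
  -- -e₅₄, -e₅₁ of `nineStage`.
  have b32 := neg (abs_nineStage_sub_le OrderCoeffs.e32 (by simp) hx hx₀)
  have b56 := neg (abs_nineStage_sub_le OrderCoeffs.e56 (by simp) hx hx₀)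
  have b52 := neg (abs_nineStage_sub_le OrderCoeffs.e52 (by simp) hx hx₀)
  have b54 := neg (abs_nineStage_sub_le OrderCoeffs.e54 (by simp) hx hx₀)
  have b51 := neg (abs_nineStage_sub_le OrderCoeffs.e51 (by simp) hx hx₀)
  refine ⟨![0, (1 - x 2) / 2, x 2 / 2, x 2 / 2, (1 - x 2) / 2],
    ![(1 - x 1) / 2, (x 1 - x 0) / 2, x 0, (x 1 - x 0) / 2, (1 - x 1) / 2],
    ⟨isClassB_nineStage _ _ _, ?_, ?_, ?_, ?_, ?_, ?_, ?_⟩, ?_, ?_, ?_, ?_, ?_, ?_⟩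
  · intro j; fin_cases j <;> simp <;> linarith
  · intro j; fin_cases j <;> simp <;> linarith
  · rw [orderCoeffs_nineStage_classB]; rfl
  · rw [orderCoeffs_nineStage_classB]; rfl
  · rw [orderCoeffs_nineStage_classB]; exact neg_eq_zero.2 h31
  · rw [orderCoeffs_nineStage_classB]; exact neg_eq_zero.2 h55
  · rw [orderCoeffs_nineStage_classB]; exact neg_eq_zero.2 h53
  · simp only [Matrix.cons_val_zero, abs_le]; constructor <;> linarith
  · simp only [Matrix.cons_val_one, Matrix.cons_val_zero, abs_le]; constructor <;> linarith
  · simp only [Matrix.cons_val, abs_le]; constructor <;> linarith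
  · simp only [Matrix.cons_val_one, Matrix.cons_val_zero, abs_le]; constructor <;> linarith
  · simp only [Matrix.cons_val, abs_le]; constructor <;> linarith
  · rw [e51Tilde, orderCoeffs_nineStage_classB]
    refine ⟨(abs_sub_le_of_approx (ε := 9e-17) b32 ?_).trans (by norm_num),
      (abs_sub_sq_le (ε := 9e-17) b56 b32 (by norm_num) ?_ ?_).trans (by norm_num),
      (abs_sub_le_of_approx (ε := 9e-17) b52 ?_).trans (by norm_num),
      (abs_sub_le_of_approx (ε := 9e-17) b54 ?_).trans (by norm_num),
      (abs_sub_le_of_approx (ε := 9e-17) b51 ?_).trans (by norm_num)⟩ <;>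
    simp [nineStage, approxB, abs_le] <;> norm_num

end Tables

end PHSplitting

theorem mainTheorem8 :
    -- the order coefficients are well defined for symmetric schemes
    (∀ (m : ℕ) (a b : Fin m → ℝ), PHSplitting.IsClassA a b ∨ PHSplitting.IsClassB a b →
      ∃! e : PHSplitting.OrderCoeffs, PHSplitting.IsOrderExpansion a b e) ∧
    -- case a
    (∀ (n : ℕ) (J R : Matrix (Fin n) (Fin n) ℝ), J.transpose = -J → R.PosSemidef →
      ⁅-R, PHSplitting.commD (-R) J⁆ = 0 →
      ∀ (m : ℕ), 5 ≤ m → ∀ (a b : Fin m → ℝ), PHSplitting.SolvesClassA a b →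
        (PHSplitting.commC (-R) J).transpose = -PHSplitting.commC (-R) J ∧
        (PHSplitting.gradientA a b (-R) J).transpose = -PHSplitting.gradientA a b (-R) J ∧
        ∀ (ζ₁ ζ₂ : Fin m → ℝ), PHSplitting.IsClassA ζ₁ ζ₂ → ∑ j, (ζ₁ j + ζ₂ j) = 1 →
          PHSplitting.HasOrder
            (PHSplitting.scheme a b ζ₁ ζ₂ (-R) J (PHSplitting.gradientA a b (-R) J)) (J - R) 6 ∧
          PHSplitting.DissipationPreserving
            (PHSplitting.scheme a b ζ₁ ζ₂ (-R) J (PHSplitting.gradientA a b (-R) J))) ∧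
    -- case b
    (∀ (n : ℕ) (J R : Matrix (Fin n) (Fin n) ℝ), J.transpose = -J → R.PosSemidef →
      ⁅J, PHSplitting.commD (-R) J⁆ = 0 →
      ∀ (m : ℕ), 5 ≤ m → ∀ (a b : Fin m → ℝ), PHSplitting.SolvesClassB a b →
        (PHSplitting.commC (-R) J).transpose = -PHSplitting.commC (-R) J ∧
        (PHSplitting.gradientB a b (-R) J).transpose = -PHSplitting.gradientB a b (-R) J ∧
        ∀ (ζ₁ ζ₂ : Fin m → ℝ), PHSplitting.IsClassB ζ₁ ζ₂ → ∑ j, (ζ₁ j + ζ₂ j) = 1 →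
          PHSplitting.HasOrder
            (PHSplitting.scheme a b ζ₁ ζ₂ (-R) J (PHSplitting.gradientB a b (-R) J)) (J - R) 6 ∧
          PHSplitting.DissipationPreserving
            (PHSplitting.scheme a b ζ₁ ζ₂ (-R) J (PHSplitting.gradientB a b (-R) J))) ∧
    -- the tabulated 9-stage solution of class a (here `a 0`, `a 1`, … are `a_1`, `a_2`, …)
    (∃ a b : Fin 5 → ℝ, PHSplitting.SolvesClassA a b ∧
      |a 0 - 0.0741652386084523| ≤ 5e-16 ∧
      |a 1 - 0.3312015955219320| ≤ 5e-16 ∧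
      |a 2 - 0.1892663317392310| ≤ 5e-16 ∧
      |b 0 - 0.2357603332527950| ≤ 5e-16 ∧
      |b 1 - 0.2642396667472050| ≤ 5e-16 ∧
      |(PHSplitting.orderCoeffs a b).e31 - 3.4513723374828328e-3| ≤ 1e-16 ∧
      |PHSplitting.e51Tilde a b - (-2.8754632332335723e-5)| ≤ 1e-16 ∧
      |(PHSplitting.orderCoeffs a b).e53 - (-7.1694217000153600e-6)| ≤ 1e-16 ∧
      |(PHSplitting.orderCoeffs a b).e52 - (-4.2236874448321610e-5)| ≤ 1e-16 ∧
      |(PHSplitting.orderCoeffs a b).e55 - (-1.3885239090889685e-5)| ≤ 1e-16) ∧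
    -- the tabulated 9-stage solution of class b
    (∃ a b : Fin 5 → ℝ, PHSplitting.SolvesClassB a b ∧
      |b 0 - 0.0951068381417148| ≤ 5e-16 ∧
      |b 1 - 0.2665630297195250| ≤ 5e-16 ∧
      |b 2 - 0.2766602642775210| ≤ 5e-16 ∧
      |a 1 - 0.2216735783842150| ≤ 5e-16 ∧
      |a 2 - 0.2783264216157850| ≤ 5e-16 ∧
      |(PHSplitting.orderCoeffs a b).e31 - 2.7595070959696467e-3| ≤ 1e-16 ∧
      |PHSplitting.e51Tilde a b - (-1.4777636968353257e-5)| ≤ 1e-16 ∧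
      |(PHSplitting.orderCoeffs a b).e55 - 1.3097476006184691e-5| ≤ 1e-16 ∧
      |(PHSplitting.orderCoeffs a b).e53 - 1.2345801613546542e-5| ≤ 1e-16 ∧
      |(PHSplitting.orderCoeffs a b).e56 - 1.5869088947135458e-5| ≤ 1e-16) := by

  refine ⟨fun m a b h => PHSplitting.existsUnique_isOrderExpansion h, ?_, ?_,
    PHSplitting.exists_tabulated_classA, PHSplitting.exists_tabulated_classB⟩
  · intro n J R hJ hR hD m _ a b hab
    have hC := PHSplitting.commC_skew hJ hR
    have hZ := PHSplitting.gradientA_skew a b hJ hR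
    refine ⟨hC, hZ, fun ζ₁ ζ₂ hζ hsum =>
      ⟨?_, PHSplitting.dissipationPreserving_scheme hab.a_nonneg hR hJ hC hZ⟩⟩
    obtain ⟨l, hp, hl⟩ := hab.isClassA.exists_palindrome hζ
    rw [show J - R = -R + J by abel]
    exact PHSplitting.scheme_hasOrder hp hl hsum hab.e11 hab.e12 hab.e32 _ _ _
      (PHSplitting.gradientA_eq hab hD)
  · intro n J R hJ hR hD m _ a b hab
    have hC := PHSplitting.commC_skew hJ hR
    have hZ := PHSplitting.gradientB_skew a b hJ hR
    refine ⟨hC, hZ, fun ζ₁ ζ₂ hζ hsum =>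
      ⟨?_, PHSplitting.dissipationPreserving_scheme hab.a_nonneg hR hJ hC hZ⟩⟩
    obtain ⟨l, hp, hl⟩ := hab.isClassB.exists_palindrome hζ
    rw [show J - R = -R + J by abel]
    exact PHSplitting.scheme_hasOrder hp hl hsum hab.e11 hab.e12 hab.e32 _ _ _
      (PHSplitting.gradientB_eq hab hD)
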